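/- Theorem 1 (Generic stabilisability with extended time-delayed feedback). Let $f:\mathbb{R}^n\times\mathbb{R}\to\mathbb{R}^n$ be $C^\infty$, and assume that $\dot x(t)=f(x(t),u(t))$ with $u=0$ has a (non-constant) periodic orbit $x_*$ of period $T>0$. Put $A(t)=\partial_xf(x_*(t),0)$ and $b(t)=\partial_uf(x_*(t),0)$, let the monodromy matrix $P_0$ be the value at time $T$ of the solution of $\dot y(t)=A(t)y(t)$, $y(0)=I$, and assume that $P_0$ is controllable with $b_0=b(0)$, that is, $\det[b_0,P_0b_0,\ldots,P_0^{n-1}b_0]\neq0$. For $\delta\in(0,T)$ let $\Delta_\delta$ be the $T$-periodic function with $\Delta_\delta(t)=1/\delta$ if $t \bmod [0,T)\in[0,\delta]$ and $\Delta_\delta(t)=0$ otherwise. For $K_0\in\mathbb{R}^n$ and $\epsilon\in(0,1)$ consider the controlled system $$\dot x(t)=f(x(t),u(t)),\qquad u(t)=\Delta_\delta(t)K_0^T[\tilde x(t)-x(t)],\qquad \tilde x(t)=(1-\epsilon)\tilde x(t-T)+\epsilon x(t-T),$$ which has the periodic orbit $(x,\tilde x)=(x_*,x_*)$. The Floquet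 multipliers of this orbit are the eigenvalues of the time-$T$ map $M$ of the linearised system $$\dot x(t)=A(t)x(t)+b(t)\Delta_\delta(t)K_0^T[\tilde x(t)-x(t)],\qquad \tilde x(t)=(1-\epsilon)\tilde x(t-T)+\epsilon x(t-T),$$ acting on the complexified phase space of all $(x,\tilde x)\in C([-T,0];\mathbb{C}^n\times\mathbb{C}^n)$ with $\tilde x(0)=(1-\epsilon)\tilde x(-T)+\epsilon x(-T)$; the differential equation is understood in integrated form because $\Delta_\delta$ is discontinuous. A Floquet multiplier is simple if its generalised eigenspace $\bigcup_k\ker(M-\lambda)^k$ has dimension one. Then there exist gains $K_0\in\mathbb{R}^n$, $\epsilon_0>0$ and $\delta_0>0$ such that for all $\epsilon\in(0,\epsilon_0)$ and all $\delta\in(0,\delta_0)$ the time-$T$ map $M$ is well defined, $1$ is a simple Floquet multiplier of $x_*$ as a periodic orbit of the controlled system, and all other Floquet multipliers have modulus strictly less than $1$. -/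

import Mathlib

open Set
open scoped ContDiff

noncomputable section

namespace DelayedFeedback

/-- `xs` is a (non-constant) periodic orbit, with period `T > 0`, of the uncontrolled system
`x' = f(x, 0)` on `ℝⁿ`. An equilibrium does not count as a periodic orbit. -/
structure IsPeriodicOrbit {n : ℕ} (f : (Fin n → ℝ) × ℝ → (Fin n → ℝ)) (T : ℝ)
    (xs : ℝ → Fin n → ℝ) : Prop where
  period_pos : 0 < T
  solves : ∀ t, HasDerivAt xs (f (xs t, 0)) t
  periodic : Function.Periodic xs T
  nonconstant : ∃ t, xs t ≠ xs 0

/-- The Jacobian matrix `A(t) = ∂ₓf(xs(t), 0)`. -/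
def jacX {n : ℕ} (f : (Fin n → ℝ) × ℝ → (Fin n → ℝ)) (xs : ℝ → Fin n → ℝ) (t : ℝ) :
    Matrix (Fin n) (Fin n) ℝ :=
  LinearMap.toMatrix'
    (fderiv ℝ (fun x : Fin n → ℝ => f (x, 0)) (xs t) : (Fin n → ℝ) →ₗ[ℝ] (Fin n → ℝ))

/-- The input vector `b(t) = ∂ᵤf(xs(t), 0)`. -/
def jacU {n : ℕ} (f : (Fin n → ℝ) × ℝ → (Fin n → ℝ)) (xs : ℝ → Fin n → ℝ) (t : ℝ) :
    Fin n → ℝ :=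
  deriv (fun u : ℝ => f (xs t, u)) 0

/-- `P₀` is the monodromy matrix of the uncontrolled orbit from time `0` to `T`: the value at
time `T` of the matrix solution of `y'(t) = A(t) y(t)`, `y(0) = I`. -/
def IsMonodromyMatrix {n : ℕ} (f : (Fin n → ℝ) × ℝ → (Fin n → ℝ)) (T : ℝ)
    (xs : ℝ → Fin n → ℝ) (P₀ : Matrix (Fin n) (Fin n) ℝ) : Prop :=
  ∃ Y : ℝ → Matrix (Fin n) (Fin n) ℝ,
    Y 0 = 1 ∧
    (∀ t ∈ Icc (0 : ℝ) T, ∀ i j,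
      HasDerivWithinAt (fun s => Y s i j) ((jacX f xs t * Y t) i j) (Icc 0 T) t) ∧
    Y T = P₀

/-- The pair `(P, b)` is controllable: `det [b, P b, …, Pⁿ⁻¹ b] ≠ 0`. -/
def IsControllable {n : ℕ} (P : Matrix (Fin n) (Fin n) ℝ) (b : Fin n → ℝ) : Prop :=
  (Matrix.of fun i j : Fin n => ((P ^ (j : ℕ)).mulVec b) i).det ≠ 0

/-- The `T`-periodic near-impulse `Δ_δ`: it is `1/δ` if `t mod [0,T)` lies in `[0, δ]`, and `0`
otherwise. -/
def impulse {T : ℝ} (hT : 0 < T) (δ t : ℝ) : ℝ :=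
  open Classical in if toIcoMod hT 0 t ∈ Icc 0 δ then 1 / δ else 0

/-- Right-hand side of the controlled equation at time `t`, as a function of the current values
`p = (x, x̃)`: it is `f(x, u)` with `u = Δ_δ(t) K₀ᵀ (x̃ - x)`. -/
def controlledField {n : ℕ} (f : (Fin n → ℝ) × ℝ → (Fin n → ℝ)) {T : ℝ} (hT : 0 < T)
    (δ : ℝ) (K₀ : Fin n → ℝ) (t : ℝ) (p : (Fin n → ℝ) × (Fin n → ℝ)) : Fin n → ℝ :=
  f (p.1, impulse hT δ t * (K₀ ⬝ᵥ (p.2 - p.1)))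

/-- The complex-linear extension of a real-linear map `ℝⁿ × ℝⁿ → ℝⁿ` to `ℂⁿ × ℂⁿ → ℂⁿ`. -/
def complexExt {n : ℕ} (L : (Fin n → ℝ) × (Fin n → ℝ) →L[ℝ] (Fin n → ℝ))
    (z : (Fin n → ℂ) × (Fin n → ℂ)) : Fin n → ℂ := fun i =>
  ((L (fun k => (z.1 k).re, fun k => (z.2 k).re) i : ℝ) : ℂ) +
    ((L (fun k => (z.1 k).im, fun k => (z.2 k).im) i : ℝ) : ℂ) * Complex.I

/-- The linearisation of the right-hand side of the controlled equation along
`(x, x̃) = (xs, xs)`, acting on complex vectors. Explicitly,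
`(x, x̃) ↦ A(t) x + b(t) Δ_δ(t) K₀ᵀ (x̃ - x)`. -/
def linearizedField {n : ℕ} (f : (Fin n → ℝ) × ℝ → (Fin n → ℝ)) {T : ℝ} (hT : 0 < T)
    (xs : ℝ → Fin n → ℝ) (δ : ℝ) (K₀ : Fin n → ℝ) (t : ℝ)
    (z : (Fin n → ℂ) × (Fin n → ℂ)) : Fin n → ℂ :=
  complexExt (fderiv ℝ (controlledField f hT δ K₀ t) (xs t, xs t)) z

/-- The (complexified) phase space of the controlled system: continuous histories `(x, x̃)` on
`[-T, 0]` that satisfy the compatibility condition `x̃(0) = (1-ε) x̃(-T) + ε x(-T)`. -/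
def phaseSpace (n : ℕ) {T : ℝ} (hT : 0 < T) (ε : ℝ) :
    Submodule ℂ C(Icc (-T) (0 : ℝ), (Fin n → ℂ) × (Fin n → ℂ)) where
  carrier := {z |
    (z ⟨0, by simp [hT.le]⟩).2 =
      ((1 - ε : ℝ) : ℂ) • (z ⟨-T, by simp [hT.le]⟩).2 +
        (ε : ℂ) • (z ⟨-T, by simp [hT.le]⟩).1}
  zero_mem' := by simp
  add_mem' := by
    intro a b ha hb
    simp only [mem_ofPred_eq, ContinuousMap.add_apply, Prod.fst_add, Prod.snd_add] at *
    rw [ha, hb]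
    module
  smul_mem' := by
    intro c a ha
    simp only [mem_ofPred_eq, ContinuousMap.smul_apply, Prod.smul_fst, Prod.smul_snd] at *
    rw [ha]
    module

instance (n : ℕ) {T : ℝ} (hT : 0 < T) (ε : ℝ) : AddCommGroup (phaseSpace n hT ε) :=
  Submodule.addCommGroup (phaseSpace n hT ε)

/-- `p = (x, x̃)` is a continuous function on `[-T, T]` solving on `[0, T]` the linearised
controlled system: the differential equation for `x` (in integrated form, since `Δ_δ` jumps)
and the recursion `x̃(t) = (1-ε) x̃(t-T) + ε x(t-T)`. -/
structure IsLinearizedSolution {n : ℕ} (f : (Fin n → ℝ) × ℝ → (Fin n → ℝ)) {T : ℝ}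
    (hT : 0 < T) (xs : ℝ → Fin n → ℝ) (δ ε : ℝ) (K₀ : Fin n → ℝ)
    (p : ℝ → (Fin n → ℂ) × (Fin n → ℂ)) : Prop where
  continuousOn : ContinuousOn p (Icc (-T) T)
  ode : ∀ t ∈ Icc (0 : ℝ) T,
    (p t).1 = (p 0).1 + ∫ s in (0 : ℝ)..t, linearizedField f hT xs δ K₀ s (p s)
  recursion : ∀ t ∈ Icc (0 : ℝ) T,
    (p t).2 = ((1 - ε : ℝ) : ℂ) • (p (t - T)).2 + (ε : ℂ) • (p (t - T)).1

/-- `M` is the time-`T` map of the linearised controlled system on its phase space: `M z = w`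
holds exactly if there is a solution with history `z` on `[-T, 0]` whose restriction to `[0, T]`,
shifted back to `[-T, 0]`, is `w`. (In particular every history has a solution, and the
final segment is unique.) -/
def IsTimeTMap {n : ℕ} (f : (Fin n → ℝ) × ℝ → (Fin n → ℝ)) {T : ℝ} (hT : 0 < T)
    (xs : ℝ → Fin n → ℝ) (δ ε : ℝ) (K₀ : Fin n → ℝ)
    (M : Module.End ℂ (phaseSpace n hT ε)) : Prop :=
  ∀ z w : phaseSpace n hT ε, M z = w ↔
    ∃ p : ℝ → (Fin n → ℂ) × (Fin n → ℂ),
      IsLinearizedSolution f hT xs δ ε K₀ p ∧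
      (∀ t : Icc (-T) (0 : ℝ), p t = z.1 t) ∧
      (∀ t : Icc (-T) (0 : ℝ), p (t + T) = w.1 t)

end DelayedFeedback

end

/-!
The linearised delay equation has rank-one control, and its Floquet multipliers reduce to a matrix
problem. For a multiplier `λ` the recursion for `x̃` gives `x̃ = ε / (λ - 1 + ε) x`, so that `x`
solves `x' = A x - μ Δ_δ b Kᵀ x` with `μ = (λ - 1) / (λ - 1 + ε)` and `x(T) = λ x(0)`. In the
coordinates `X = Y⁻¹ x` moving with the uncontrolled flow, and with time scaled by `δ`, this is an
equation on `[0, 1]` (`impulsive_variation_of_constants`) that tends to `X' = -μ b₀ Kᵀ X` as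
`δ → 0`. Hence `λ` is in the limit an eigenvalue of `P₀ exp (-μ b₀ Kᵀ)`.

If `|λ| ≥ 1`, then `μ` lies almost in the disc `|μ|² ≤ Re μ`, whatever `ε`
(`feedback_factor_bound`), and `μ → 1` as `ε → 0` if `λ` stays away from `1`. By pole placement
(`exists_stabilizing_gain`) `K` can be chosen such that `P₀ exp (-b₀ Kᵀ)` has its spectrum in the
open unit disc, with `κ = Kᵀ b₀ > 0`. This excludes all unstable multipliers away from `1`. To
exclude those near `1`, pair the equation with a left eigenvector `w` of `P₀` for the eigenvalue
`1`: in the limit, `φ(μ) (Kᵀ y) (w b₀) = 0` with `φ(μ) = (1 - exp (-μ κ)) / (μ κ)`. By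
controllability `w b₀ ≠ 0`, and `φ` has no zero in the disc, so `Kᵀ y = 0` and `y = P₀ y` is fixed
by the stable closed loop too, which is absurd. A generalised eigenvector of order two for the
multiplier `1` satisfies the same equations with `μ = 0`, so the same argument shows that `1` is
simple. A compactness argument (`exists_excludesUnstable`) makes this uniform in `ε` and `δ`.
-/

namespace DelayedFeedback

open MeasureTheory Filter Topology
open scoped Matrix

/-! ### Volterra equations and linear differential equations -/

/-- Global existence and uniqueness for `x(t) = x₀ + ∫₀ᵗ F(s, x(s)) ds` on `[0, T]` when `F` is
Lipschitz in `x`, with no continuity in time. -/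
theorem exists_unique_volterra {E : Type*} [NormedAddCommGroup E] [NormedSpace ℝ E]
    [CompleteSpace E] {T : ℝ} (hT : 0 ≤ T) (F : ℝ → E → E) (L : ℝ) (hL0 : 0 ≤ L)
    (hL : ∀ t ∈ Icc 0 T, ∀ x y, ‖F t x - F t y‖ ≤ L * ‖x - y‖)
    (hF : ∀ x : ℝ → E, Continuous x → IntervalIntegrable (fun s => F s (x s)) volume 0 T)
    (x₀ : E) :
    ∃ x : ℝ → E, Continuous x ∧ (∀ t ∈ Icc 0 T, x t = x₀ + ∫ s in (0 : ℝ)..t, F s (x s)) ∧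
      ∀ y : ℝ → E, ContinuousOn y (Icc 0 T) →
        (∀ t ∈ Icc 0 T, y t = x₀ + ∫ s in (0 : ℝ)..t, F s (y s)) → EqOn y x (Icc 0 T) := by
  -- In the unknown `w(t) = exp (-c t) x(t)`, `c > L`, the Picard map is a contraction.
  set c : ℝ := 2 * L + 1 with hc
  have hc0 : 0 < c := by positivity
  let lift : C(Icc (0 : ℝ) T, E) → ℝ → E := fun w s => Real.exp (c * s) • IccExtend hT w s
  have hlift : ∀ w, Continuous (lift w) := fun w => by
    have := (w.continuous).Icc_extend' (h := hT)
    fun_prop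
  have hint : ∀ w, ∀ t ∈ Icc 0 T, IntervalIntegrable (fun s => F s (lift w s)) volume 0 t := by
    intro w t ht
    refine (hF _ (hlift w)).mono_set ?_
    rw [uIcc_of_le ht.1, uIcc_of_le hT]
    exact Icc_subset_Icc_right ht.2
  let Φ : C(Icc (0 : ℝ) T, E) → C(Icc (0 : ℝ) T, E) := fun w =>
    ⟨fun t => Real.exp (-(c * t)) • (x₀ + ∫ s in (0 : ℝ)..t, F s (lift w s)), by
      have h1 : ContinuousOn (fun t => ∫ s in (0 : ℝ)..t, F s (lift w s)) (Icc 0 T) := by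
        have := intervalIntegral.continuousOn_primitive_interval' (hF _ (hlift w)) left_mem_uIcc
        rwa [uIcc_of_le hT] at this
      have h2 := continuousOn_iff_continuous_domRestrict.1 h1
      have h3 : Continuous fun t : Icc (0 : ℝ) T => ∫ s in (0 : ℝ)..t, F s (lift w s) := h2
      fun_prop⟩
  have hΦ : ContractingWith (1 / 2) Φ := by
    refine ⟨by rw [← NNReal.coe_lt_coe]; norm_num, LipschitzWith.of_dist_le_mul fun w v => ?_⟩
    rw [NNReal.coe_div, NNReal.coe_one, NNReal.coe_ofNat,
      ContinuousMap.dist_le (mul_nonneg (by norm_num) dist_nonneg)]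
    intro t
    have ht := t.2
    have key : ‖(∫ s in (0 : ℝ)..t, F s (lift w s)) - ∫ s in (0 : ℝ)..t, F s (lift v s)‖ ≤
        ∫ s in (0 : ℝ)..t, L * dist w v * Real.exp (c * s) := by
      rw [← intervalIntegral.integral_sub (hint w t ht) (hint v t ht)]
      refine intervalIntegral.norm_integral_le_of_norm_le ht.1 (ae_of_all _ fun s hs => ?_)
        (Continuous.intervalIntegrable (by fun_prop) _ _)
      have hs' : s ∈ Icc 0 T := ⟨hs.1.le, hs.2.trans ht.2⟩
      refine (hL s hs' _ _).trans ?_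
      have : ‖lift w s - lift v s‖ ≤ Real.exp (c * s) * dist w v := by
        simp only [lift]
        rw [← smul_sub, norm_smul, Real.norm_of_nonneg (Real.exp_pos _).le,
          IccExtend_of_mem _ _ hs', IccExtend_of_mem _ _ hs', ← dist_eq_norm]
        gcongr
        exact ContinuousMap.dist_apply_le_dist _
      calc _ ≤ L * (Real.exp (c * s) * dist w v) := by gcongr
        _ = _ := by ring
    have hI : ∫ s in (0 : ℝ)..t, L * dist w v * Real.exp (c * s) =
        L * dist w v * ((Real.exp (c * t) - 1) / c) := by
      rw [intervalIntegral.integral_const_mul]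
      congr 1
      have : ∀ s ∈ uIcc (0 : ℝ) t,
          HasDerivAt (fun s => Real.exp (c * s) / c) (Real.exp (c * s)) s := fun s _ =>
        ((((hasDerivAt_id s).const_mul c).exp).div_const c).congr_deriv (by simp [hc0.ne'])
      rw [intervalIntegral.integral_eq_sub_of_hasDerivAt this
        (Continuous.intervalIntegrable (by fun_prop) _ _)]
      simp
      ring
    rw [hI] at key
    change dist (Real.exp (-(c * t)) • (x₀ + ∫ s in (0 : ℝ)..t, F s (lift w s)))
      (Real.exp (-(c * t)) • (x₀ + ∫ s in (0 : ℝ)..t, F s (lift v s))) ≤ 1 / 2 * dist w v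
    rw [dist_eq_norm, ← smul_sub, norm_smul, Real.norm_of_nonneg (Real.exp_pos _).le,
      add_sub_add_left_eq_sub]
    calc _ ≤ Real.exp (-(c * t)) * (L * dist w v * ((Real.exp (c * t) - 1) / c)) := by gcongr
      _ = (L / c) * dist w v * (1 - Real.exp (-(c * t))) := by
          rw [Real.exp_neg]
          field_simp
      _ ≤ (1 / 2) * dist w v * 1 := by
          have h1 : L / c ≤ 1 / 2 := by
            rw [div_le_iff₀ hc0]; linarith
          have h2 : 0 ≤ 1 - Real.exp (-(c * t)) := by
            have : 0 ≤ c * (t : ℝ) := mul_nonneg hc0.le ht.1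
            simpa using this
          gcongr
          linarith [Real.exp_pos (-(c * t))]
      _ = _ := by ring
  set w := ContractingWith.fixedPoint Φ hΦ with hw
  have hfix : Φ w = w := hΦ.fixedPoint_isFixedPt
  refine ⟨lift w, hlift w, fun t ht => ?_, fun y hy hyt t ht => ?_⟩
  · have h1 : Φ w ⟨t, ht⟩ = w ⟨t, ht⟩ := by rw [hfix]
    have h2 : Real.exp (-(c * t)) • (x₀ + ∫ s in (0 : ℝ)..t, F s (lift w s)) = w ⟨t, ht⟩ := h1
    simp only [lift]
    rw [IccExtend_of_mem _ _ ht, ← h2, smul_smul, ← Real.exp_add]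
    simp [lift]
  · let v : C(Icc (0 : ℝ) T, E) := ⟨fun t => Real.exp (-(c * t)) • y t, by
      have h3 : Continuous fun t : Icc (0 : ℝ) T => y t :=
        continuousOn_iff_continuous_domRestrict.1 hy
      exact Continuous.smul (by fun_prop) h3⟩
    have hv : ∀ t ∈ Icc 0 T, lift v t = y t := fun t ht => by
      simp only [lift]
      rw [IccExtend_of_mem _ _ ht]
      simp only [v, ContinuousMap.coe_mk, smul_smul]
      rw [← Real.exp_add]
      simp
    have hvfix : Φ v = v := by
      ext t
      change Real.exp (-(c * t)) • (x₀ + ∫ s in (0 : ℝ)..t, F s (lift v s)) =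
        Real.exp (-(c * t)) • y t
      rw [hyt t t.2]
      congr 2
      refine intervalIntegral.integral_congr fun s hs => ?_
      rw [uIcc_of_le t.2.1] at hs
      rw [hv s ⟨hs.1, hs.2.trans t.2.2⟩]
    have : v = w := hΦ.fixedPoint_unique hvfix
    rw [← hv t ht, this]

/-- The fundamental theorem of calculus in the form needed to pass from integral equations to
differential equations on a closed interval. -/
theorem hasDerivWithinAt_of_eq_integral {E : Type*} [NormedAddCommGroup E] [NormedSpace ℝ E]
    [CompleteSpace E] {a b : ℝ} (hab : a ≤ b) {x g : ℝ → E} (hg : ContinuousOn g (Icc a b))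
    {x₀ : E} (hx : ∀ t ∈ Icc a b, x t = x₀ + ∫ s in a..t, g s) {t : ℝ} (ht : t ∈ Icc a b) :
    HasDerivWithinAt x (g t) (Icc a b) t := by
  set G := IccExtend hab ((Icc a b).domRestrict g) with hG
  have hGc : Continuous G := (continuousOn_iff_continuous_domRestrict.1 hg).Icc_extend'
  have hGg : ∀ s ∈ Icc a b, G s = g s := fun s hs => by rw [hG, IccExtend_of_mem _ _ hs]; rfl
  have h := ((hGc.integral_hasStrictDerivAt a t).hasDerivAt.const_add x₀).hasDerivWithinAt
    (s := Icc a b)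
  rw [hGg t ht] at h
  have hcongr : ∀ s ∈ Icc a b, x s = x₀ + ∫ r in a..s, G r := fun s hs => by
    rw [hx s hs]
    congr 1
    refine intervalIntegral.integral_congr fun r hr => ?_
    rw [uIcc_of_le hs.1] at hr
    exact (hGg r ⟨hr.1, hr.2.trans hs.2⟩).symm
  exact h.congr hcongr (hcongr t ht)

/-- Converse of `hasDerivWithinAt_of_eq_integral`. -/
theorem eq_integral_of_hasDerivWithinAt {E : Type*} [NormedAddCommGroup E] [NormedSpace ℝ E]
    [CompleteSpace E] {a b : ℝ} {x g : ℝ → E} (hg : ContinuousOn g (Icc a b))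
    (hx : ∀ t ∈ Icc a b, HasDerivWithinAt x (g t) (Icc a b) t) {t : ℝ} (ht : t ∈ Icc a b) :
    x t = x a + ∫ s in a..t, g s := by
  have hsub : Icc a t ⊆ Icc a b := Icc_subset_Icc_right ht.2
  rw [intervalIntegral.integral_eq_sub_of_hasDeriv_right (f := x) (f' := g)]
  · abel
  · rw [uIcc_of_le ht.1]
    exact fun s hs => ((hx s (hsub hs)).continuousWithinAt).mono hsub
  · intro s hs
    rw [min_eq_left ht.1, max_eq_right ht.1] at hs
    have hmem : s ∈ Icc a b := ⟨hs.1.le, hs.2.le.trans ht.2⟩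
    exact (hx s hmem).mono_of_mem_nhdsWithin
      (mem_nhdsWithin_of_mem_nhds (Icc_mem_nhds hs.1 (hs.2.trans_le ht.2)))
  · refine ContinuousOn.intervalIntegrable ?_
    rw [uIcc_of_le ht.1]
    exact hg.mono hsub

/-! ### Pole placement -/

section PolePlacement

variable {n m : ℕ} (P : Matrix (Fin n) (Fin n) ℂ) (b l : Fin n → ℂ)

/-- If `ℓ Pʲ⁺¹ b = 0` for `j < m` and `ℓ Pᵐ⁺¹ b = 1`, then `ℓ, ℓ P, …, ℓ Pᵐ` separate the points
of the span of `P b, …, Pᵐ⁺¹ b`: the Hankel matrix of the values `ℓ Pⁱ⁺ʲ⁺¹ b` is triangular. -/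
theorem eq_zero_of_hankel (h0 : ∀ j < m, l ⬝ᵥ (P ^ (j + 1)) *ᵥ b = 0)
    (h1 : l ⬝ᵥ (P ^ (m + 1)) *ᵥ b = 1) (a : Fin (m + 1) → ℂ)
    (hx : ∀ j ≤ m, l ⬝ᵥ (P ^ j) *ᵥ (∑ i, a i • (P ^ ((i : ℕ) + 1)) *ᵥ b) = 0) : a = 0 := by
  by_contra hne
  obtain ⟨i₀, hi₀⟩ := Function.ne_iff.1 hne
  obtain ⟨i, hi, hmax⟩ := (Finset.univ.filter fun i => a i ≠ 0).exists_max_image (fun i => i)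
    ⟨i₀, by simpa using hi₀⟩
  simp only [Finset.mem_filter, Finset.mem_univ, true_and] at hi hmax
  refine hi ?_
  have := hx (m - i) (Nat.sub_le _ _)
  rw [Matrix.mulVec_sum, dotProduct_sum, Finset.sum_eq_single i] at this
  · rw [Matrix.mulVec_smul, dotProduct_smul, Matrix.mulVec_mulVec, ← pow_add,
      show m - (i : ℕ) + (i + 1) = m + 1 by omega, h1] at this
    simpa using this
  · intro k _ hk
    by_cases hak : a k = 0
    · simp [hak]
    · have hlt : k < i := lt_of_le_of_ne (hmax k hak) hk
      have hlt' : (k : ℕ) < i := hlt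
      rw [Matrix.mulVec_smul, dotProduct_smul, Matrix.mulVec_mulVec, ← pow_add, ← add_assoc,
        h0 _ (by omega), smul_zero]
  · simp

/-- Ackermann's formula: with the gain `ℓ Pᵐ⁺¹ + c ℓ` the closed loop matrix is annihilated by
`λᵐ⁺¹ + c`. -/
theorem closedLoop_eigenvalue_pow (h0 : ∀ j < m, l ⬝ᵥ (P ^ (j + 1)) *ᵥ b = 0)
    (h1 : l ⬝ᵥ (P ^ (m + 1)) *ᵥ b = 1) (c lam : ℂ) {x : Fin n → ℂ} (hx0 : x ≠ 0)
    {a : Fin (m + 1) → ℂ} (hxa : x = ∑ i, a i • (P ^ ((i : ℕ) + 1)) *ᵥ b)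
    (hx : P *ᵥ (x - (l ⬝ᵥ (P ^ (m + 1)) *ᵥ x + c * (l ⬝ᵥ x)) • b) = lam • x) :
    lam ^ (m + 1) = -c := by
  set g := l ⬝ᵥ (P ^ (m + 1)) *ᵥ x + c * (l ⬝ᵥ x) with hg
  have hPx : P *ᵥ x = lam • x + g • (P *ᵥ b) := by
    rw [← hx, Matrix.mulVec_sub, Matrix.mulVec_smul]
    abel
  have hstep : ∀ j, l ⬝ᵥ (P ^ (j + 1)) *ᵥ x =
      lam * (l ⬝ᵥ (P ^ j) *ᵥ x) + g * (l ⬝ᵥ (P ^ (j + 1)) *ᵥ b) := fun j => by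
    rw [pow_succ, ← Matrix.mulVec_mulVec, hPx, Matrix.mulVec_add, dotProduct_add,
      Matrix.mulVec_smul, Matrix.mulVec_smul, Matrix.mulVec_mulVec, dotProduct_smul,
      dotProduct_smul, smul_eq_mul, smul_eq_mul]
  have hpow : ∀ j ≤ m, l ⬝ᵥ (P ^ j) *ᵥ x = lam ^ j * (l ⬝ᵥ x) := by
    intro j
    induction j with
    | zero => simp
    | succ j ih =>
      intro hj
      rw [hstep, ih (by omega), h0 j (by omega)]
      ring
  have hlx : l ⬝ᵥ x ≠ 0 := by
    intro hlx
    refine hx0 ?_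
    have : a = 0 := eq_zero_of_hankel P b l h0 h1 a fun j hj => by
      rw [← hxa, hpow j hj, hlx, mul_zero]
    rw [hxa, this]
    simp
  have := hstep m
  rw [h1, hpow m le_rfl] at this
  have h2 : (lam ^ (m + 1) + c) * (l ⬝ᵥ x) = 0 := by
    rw [hg] at this
    linear_combination -this
  exact eq_neg_of_add_eq_zero_left ((mul_eq_zero.1 h2).resolve_right hlx)

end PolePlacement

/-- A real vector, viewed as a complex one. -/
abbrev cvec {n : ℕ} (v : Fin n → ℝ) : Fin n → ℂ := fun i => (v i : ℂ)

/-- A real matrix, viewed as a complex one. -/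
noncomputable abbrev cmat {n : ℕ} (P : Matrix (Fin n) (Fin n) ℝ) : Matrix (Fin n) (Fin n) ℂ :=
  P.map (algebraMap ℝ ℂ)

theorem cmat_mulVec {n : ℕ} (P : Matrix (Fin n) (Fin n) ℝ) (v : Fin n → ℝ) :
    cmat P *ᵥ cvec v = cvec (P *ᵥ v) := by
  ext i
  exact (RingHom.map_mulVec (algebraMap ℝ ℂ) P v i).symm

theorem cvec_dotProduct {n : ℕ} (u v : Fin n → ℝ) : cvec u ⬝ᵥ cvec v = ((u ⬝ᵥ v : ℝ) : ℂ) := by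
  simp [dotProduct]

theorem cmat_pow {n : ℕ} (P : Matrix (Fin n) (Fin n) ℝ) (k : ℕ) : cmat P ^ k = cmat (P ^ k) :=
  (map_pow (algebraMap ℝ ℂ).mapMatrix P k).symm

/-- Pole placement for the closed loop `P (I - b Gᵀ)`. Its determinant is
`det P * (1 - G b)`, so the constraint on `G b` keeps it invertible and of unchanged
orientation. -/
theorem exists_stabilizing_rank_one {n : ℕ} (hn : n ≠ 0) (P : Matrix (Fin n) (Fin n) ℝ)
    (b : Fin n → ℝ) (hP : P.det ≠ 0) (hc : IsControllable P b) :
    ∃ G : Fin n → ℝ, 0 < G ⬝ᵥ b ∧ G ⬝ᵥ b < 1 ∧ ∀ (lam : ℂ) (x : Fin n → ℂ), x ≠ 0 →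
      cmat P *ᵥ (x - (cvec G ⬝ᵥ x) • cvec b) = lam • x → ‖lam‖ < 1 := by
  obtain ⟨m, rfl⟩ := Nat.exists_eq_succ_of_ne_zero hn
  set C : Matrix (Fin (m + 1)) (Fin (m + 1)) ℝ :=
    Matrix.of fun i j : Fin (m + 1) => ((P ^ (j : ℕ)).mulVec b) i with hC
  have hCdet : C.det ≠ 0 := hc
  set H := P * C with hH
  have hHapply : ∀ i j, H i j = ((P ^ ((j : ℕ) + 1)) *ᵥ b) i := fun i j => by
    rw [pow_succ', ← Matrix.mulVec_mulVec]
    rfl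
  have hHdet : IsUnit H.det := by
    rw [hH, Matrix.det_mul]
    exact (mul_ne_zero hP hCdet).isUnit
  set l : Fin (m + 1) → ℝ := Pi.single (Fin.last m) 1 ᵥ* H⁻¹ with hl
  have hlH : l ᵥ* H = Pi.single (Fin.last m) 1 := by
    rw [hl, Matrix.vecMul_vecMul, Matrix.nonsing_inv_mul _ hHdet, Matrix.vecMul_one]
  have hlj : ∀ j : Fin (m + 1), l ⬝ᵥ (P ^ ((j : ℕ) + 1)) *ᵥ b =
      (Pi.single (Fin.last m) 1 : Fin (m + 1) → ℝ) j := fun j => by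
    rw [← hlH, Matrix.vecMul]
    congr 1
    ext i
    exact (hHapply i j).symm
  have h0 : ∀ j < m, l ⬝ᵥ (P ^ (j + 1)) *ᵥ b = 0 := fun j hj => by
    have := hlj ⟨j, by omega⟩
    rw [this, Pi.single_eq_of_ne]
    simp [Fin.ext_iff]
    omega
  have h1 : l ⬝ᵥ (P ^ (m + 1)) *ᵥ b = 1 := by
    have := hlj (Fin.last m)
    simpa using this
  have hlb : l ⬝ᵥ b ≠ 0 := by
    intro hlb
    have hlC : l ᵥ* C = 0 := by
      ext j
      change l ⬝ᵥ (P ^ (j : ℕ)) *ᵥ b = 0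
      rcases j with ⟨_ | j, hj⟩
      · simpa using hlb
      · exact h0 j (by omega)
    have hl0 : l = 0 := by
      by_contra hne
      exact hCdet (Matrix.exists_vecMul_eq_zero_iff.1 ⟨l, hne, hlC⟩)
    rw [hl0, zero_dotProduct] at h1
    exact zero_ne_one h1
  -- `G b = 1 + c (ℓ b) = 1 - τ`, and the eigenvalues are the roots of `λ ^ n = -c`.
  set τ : ℝ := min (1 / 2) (|l ⬝ᵥ b| / 2) with hτ
  have hτ0 : 0 < τ := lt_min (by norm_num) (by positivity)
  have hτ1 : τ ≤ 1 / 2 := min_le_left _ _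
  set c : ℝ := -τ / (l ⬝ᵥ b) with hcdef
  have hc1 : |c| < 1 := by
    rw [hcdef, abs_div, abs_neg, abs_of_pos hτ0, div_lt_one (by positivity)]
    have : τ ≤ |l ⬝ᵥ b| / 2 := min_le_right _ _
    have : 0 < |l ⬝ᵥ b| := by positivity
    linarith
  set G : Fin (m + 1) → ℝ := l ᵥ* P ^ (m + 1) + c • l with hG
  have hGb : G ⬝ᵥ b = 1 - τ := by
    rw [hG, add_dotProduct, ← Matrix.dotProduct_mulVec, h1, smul_dotProduct, smul_eq_mul, hcdef]
    field_simp
    ring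
  refine ⟨G, by linarith, by linarith, fun lam x hx0 hx => ?_⟩
  have hcl : ∀ k, cvec l ⬝ᵥ (cmat P ^ k) *ᵥ cvec b = ((l ⬝ᵥ (P ^ k) *ᵥ b : ℝ) : ℂ) := fun k => by
    rw [cmat_pow, cmat_mulVec, cvec_dotProduct]
  have hGx : cvec G ⬝ᵥ x = cvec l ⬝ᵥ (cmat P ^ (m + 1)) *ᵥ x + (c : ℂ) * (cvec l ⬝ᵥ x) := by
    have hGc : cvec G = cvec l ᵥ* cmat P ^ (m + 1) + (c : ℂ) • cvec l := by
      ext i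
      rw [cmat_pow, hG]
      simp [cvec, Matrix.vecMul, dotProduct]
    rw [hGc, add_dotProduct, ← Matrix.dotProduct_mulVec, smul_dotProduct, smul_eq_mul]
  have hHc : IsUnit (cmat H).det := by
    have : (cmat H).det = (algebraMap ℝ ℂ) H.det := (RingHom.map_det _ _).symm
    rw [this]
    exact hHdet.map _
  have hpow := closedLoop_eigenvalue_pow (cmat P) (cvec b) (cvec l)
    (fun j hj => by rw [hcl, h0 j hj, Complex.ofReal_zero])
    (by rw [hcl, h1, Complex.ofReal_one]) (c : ℂ) lam hx0 (a := (cmat H)⁻¹ *ᵥ x) (by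
      conv_lhs => rw [← Matrix.one_mulVec x, ← Matrix.mul_nonsing_inv _ hHc,
        ← Matrix.mulVec_mulVec]
      ext i
      simp only [Matrix.mulVec, dotProduct, Finset.sum_apply, Pi.smul_apply, smul_eq_mul]
      refine Finset.sum_congr rfl fun j _ => ?_
      rw [mul_comm]
      congr 1
      have := congrFun (cmat_mulVec (P ^ ((j : ℕ) + 1)) b) i
      rw [← cmat_pow] at this
      change ((H i j : ℝ) : ℂ) = ((cmat P ^ ((j : ℕ) + 1)) *ᵥ cvec b) i
      rw [this, hHapply]) (by rw [← hGx]; exact hx)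
  have hnorm : ‖lam‖ ^ (m + 1) < 1 := by
    rw [← norm_pow, hpow, norm_neg, Complex.norm_real]
    exact hc1
  by_contra hge
  exact absurd hnorm (not_lt.2 (one_le_pow₀ (not_lt.1 hge)))

/-- The gain `K` for impulsive feedback: `P exp (-b Kᵀ) = P (I - h b Kᵀ)` with
`h = (1 - exp (-K b)) / K b`, and this matrix has all its eigenvalues in the open unit disc. -/
theorem exists_stabilizing_gain {n : ℕ} (hn : n ≠ 0) (P : Matrix (Fin n) (Fin n) ℝ)
    (b : Fin n → ℝ) (hP : P.det ≠ 0) (hc : IsControllable P b) :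
    ∃ K : Fin n → ℝ, 0 < K ⬝ᵥ b ∧ ∀ (lam : ℂ) (x : Fin n → ℂ), x ≠ 0 →
      cmat P *ᵥ (x - ((1 - Complex.exp (-(K ⬝ᵥ b : ℝ))) / (K ⬝ᵥ b : ℝ) * (cvec K ⬝ᵥ x)) •
        cvec b) = lam • x → ‖lam‖ < 1 := by
  obtain ⟨G, hG0, hG1, hG⟩ := exists_stabilizing_rank_one hn P b hP hc
  set κ : ℝ := -Real.log (1 - G ⬝ᵥ b) with hκ
  have hκ0 : 0 < κ := by
    have := Real.log_neg (by linarith : 0 < 1 - G ⬝ᵥ b) (by linarith)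
    linarith
  have hKb : (κ / (G ⬝ᵥ b)) • G ⬝ᵥ b = κ := by
    rw [smul_dotProduct, smul_eq_mul, div_mul_cancel₀ _ hG0.ne']
  refine ⟨(κ / (G ⬝ᵥ b)) • G, by rwa [hKb], fun lam x hx0 hx => hG lam x hx0 ?_⟩
  rw [hKb] at hx
  rw [← hx]
  congr 3
  have hexp : Complex.exp (-(κ : ℂ)) = ((1 - G ⬝ᵥ b : ℝ) : ℂ) := by
    rw [← Complex.ofReal_neg, ← Complex.ofReal_exp, hκ, neg_neg, Real.exp_log (by linarith)]
  have hKx : cvec ((κ / (G ⬝ᵥ b)) • G) ⬝ᵥ x = ((κ / (G ⬝ᵥ b) : ℝ) : ℂ) * (cvec G ⬝ᵥ x) := by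
    rw [← smul_eq_mul, ← smul_dotProduct]
    congr 1
    ext i
    simp [cvec]
  have h1 : (κ : ℂ) ≠ 0 := by exact_mod_cast hκ0.ne'
  have h2 : ((G ⬝ᵥ b : ℝ) : ℂ) ≠ 0 := by exact_mod_cast hG0.ne'
  rw [hexp, hKx]
  push_cast
  field_simp
  ring

/-! ### The limit of short impulses -/

/-- The solution at time `θ` of `φ' = 1 - μ κ φ`, `φ(0) = 0`. -/
noncomputable def impulseResponse (κ μ : ℂ) (θ : ℝ) : ℂ :=
  if μ * κ = 0 then θ else (1 - Complex.exp (-(μ * κ) * θ)) / (μ * κ)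

theorem impulseResponse_zero (κ μ : ℂ) : impulseResponse κ μ 0 = 0 := by
  simp [impulseResponse]

theorem hasDerivAt_impulseResponse (κ μ : ℂ) (θ : ℝ) :
    HasDerivAt (impulseResponse κ μ) (1 - μ * κ * impulseResponse κ μ θ) θ := by
  unfold impulseResponse
  split_ifs with h
  · simpa [h] using (hasDerivAt_id θ).ofReal_comp
  · have h1 : HasDerivAt (fun t : ℝ => -(μ * κ) * (t : ℂ)) (-(μ * κ)) θ := by
      simpa using ((hasDerivAt_id θ).ofReal_comp).const_mul (-(μ * κ))
    refine ((h1.cexp.const_sub 1).div_const (μ * κ)).congr_deriv ?_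
    rw [mul_div_cancel₀ _ h, sub_sub_cancel, mul_neg, neg_neg, mul_div_cancel_right₀ _ h]

/-- The zeros of `φ(1)` are the `μ ≠ 0` with `μ κ ∈ 2πiℤ`. They lie on the imaginary axis, which
the disc `‖μ‖² ≤ Re μ` touches only at `0`. -/
theorem impulseResponse_one_ne_zero {κ : ℝ} (hκ : 0 < κ) {μ : ℂ} (hμ : ‖μ‖ ^ 2 ≤ μ.re) :
    impulseResponse κ μ 1 ≠ 0 := by
  unfold impulseResponse
  split_ifs with h
  · simp
  · refine div_ne_zero ?_ h
    intro h0
    have hexp : Complex.exp (-(μ * κ)) = 1 := by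
      simpa using (sub_eq_zero.1 h0).symm
    obtain ⟨k, hk⟩ := Complex.exp_eq_one_iff.1 hexp
    have hre := congrArg Complex.re hk
    simp at hre
    have hre0 : μ.re = 0 := hre.resolve_right hκ.ne'
    rw [hre0] at hμ
    have : μ = 0 := by
      rw [← norm_eq_zero]
      exact pow_eq_zero_iff (two_ne_zero) |>.1 (le_antisymm hμ (by positivity))
    exact h (by rw [this, zero_mul])

theorem norm_dotProduct_le {n : ℕ} (u v : Fin n → ℂ) : ‖u ⬝ᵥ v‖ ≤ n * ‖u‖ * ‖v‖ := by
  refine (norm_sum_le _ _).trans ?_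
  calc ∑ i, ‖u i * v i‖ ≤ ∑ _i : Fin n, ‖u‖ * ‖v‖ := by
        refine Finset.sum_le_sum fun i _ => ?_
        rw [norm_mul]
        gcongr
        · exact norm_le_pi_norm u i
        · exact norm_le_pi_norm v i
    _ = n * ‖u‖ * ‖v‖ := by simp [mul_assoc]

/-- Continuous dependence for the rank-one system `R' = (k (y - μ R)) β`, `R(0) = 0`, at a limit
with constant coefficients `β = b`, `k = K`, for which it is solved explicitly. -/
theorem tendsto_rank_one_ode {n : ℕ} {b K y : Fin n → ℂ} {μ : ℂ} {βs ks : ℕ → ℝ → Fin n → ℂ}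
    {ys : ℕ → Fin n → ℂ} {μs : ℕ → ℂ}
    (hβ : Tendsto (fun p : ℕ × ℝ => βs p.1 p.2) (atTop ×ˢ 𝓟 (Icc 0 1)) (𝓝 b))
    (hk : Tendsto (fun p : ℕ × ℝ => ks p.1 p.2) (atTop ×ˢ 𝓟 (Icc 0 1)) (𝓝 K))
    (hy : Tendsto ys atTop (𝓝 y)) (hμ : Tendsto μs atTop (𝓝 μ)) {R : ℕ → ℝ → Fin n → ℂ}
    (hR0 : ∀ j, R j 0 = 0)
    (hR : ∀ j, ∀ θ ∈ Icc (0 : ℝ) 1,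
      HasDerivWithinAt (R j) ((ks j θ ⬝ᵥ (ys j - μs j • R j θ)) • βs j θ) (Icc 0 1) θ) :
    Tendsto (fun j => R j 1) atTop (𝓝 ((impulseResponse (K ⬝ᵥ b) μ 1 * (K ⬝ᵥ y)) • b)) := by
  set Φ := impulseResponse (K ⬝ᵥ b) μ with hΦ
  have hΦc : Continuous Φ := continuous_iff_continuousAt.2 fun θ =>
    (hasDerivAt_impulseResponse _ _ θ).continuousAt
  obtain ⟨C, hC⟩ := (isCompact_Icc (a := (0 : ℝ)) (b := 1)).exists_bound_of_continuousOn
    hΦc.continuousOn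
  have hC0 : 0 ≤ C := (norm_nonneg _).trans (hC 0 (by simp))
  have hfst : Tendsto (Prod.fst : ℕ × ℝ → ℕ) (atTop ×ˢ 𝓟 (Icc 0 1)) atTop := tendsto_fst
  have hdot : Continuous fun p : (Fin n → ℂ) × (Fin n → ℂ) => p.1 ⬝ᵥ p.2 := by
    unfold dotProduct; fun_prop
  have hdot' : ∀ {f g : ℕ × ℝ → Fin n → ℂ} {u v : Fin n → ℂ} {F : Filter (ℕ × ℝ)},
      Tendsto f F (𝓝 u) → Tendsto g F (𝓝 v) → Tendsto (fun p => f p ⬝ᵥ g p) F (𝓝 (u ⬝ᵥ v)) :=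
    fun hf hg => (hdot.tendsto _).comp (hf.prodMk_nhds hg)
  -- Uniform Lipschitz constant of the fields.
  set L : ℝ := n * (‖μ‖ * ‖K‖ * ‖b‖) + 1 with hL
  have hLip : ∀ᶠ j in atTop, ∀ θ ∈ Icc (0 : ℝ) 1, n * (‖μs j‖ * ‖ks j θ‖ * ‖βs j θ‖) ≤ L := by
    have h : Tendsto (fun p : ℕ × ℝ => (n : ℝ) * (‖μs p.1‖ * ‖ks p.1 p.2‖ * ‖βs p.1 p.2‖))
        (atTop ×ˢ 𝓟 (Icc 0 1)) (𝓝 (n * (‖μ‖ * ‖K‖ * ‖b‖))) :=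
      (((hμ.comp hfst).norm.mul hk.norm).mul hβ.norm).const_mul _
    have := h.eventually (eventually_le_nhds (lt_add_one _))
    exact eventually_prod_principal_iff.1 this
  -- Size of the defect of the limiting solution.
  set D : ℕ → ℝ → Fin n → ℂ := fun j θ =>
    ((ks j θ ⬝ᵥ ys j) • βs j θ - (K ⬝ᵥ y) • b) -
      (Φ θ * (K ⬝ᵥ y)) • ((μs j * (ks j θ ⬝ᵥ b)) • βs j θ - (μ * (K ⬝ᵥ b)) • b) with hD
  have hdefect : ∀ η > 0, ∀ᶠ j in atTop, ∀ θ ∈ Icc (0 : ℝ) 1, ‖D j θ‖ ≤ η := by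
    intro η hη
    have h1 : Tendsto (fun p : ℕ × ℝ => (ks p.1 p.2 ⬝ᵥ ys p.1) • βs p.1 p.2 - (K ⬝ᵥ y) • b)
        (atTop ×ˢ 𝓟 (Icc 0 1)) (𝓝 0) := by
      simpa using ((hdot' hk (hy.comp hfst)).smul hβ).sub_const ((K ⬝ᵥ y) • b)
    have h2 : Tendsto (fun p : ℕ × ℝ => (μs p.1 * (ks p.1 p.2 ⬝ᵥ b)) • βs p.1 p.2 -
        (μ * (K ⬝ᵥ b)) • b) (atTop ×ˢ 𝓟 (Icc 0 1)) (𝓝 0) := by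
      simpa using (((hμ.comp hfst).mul (hdot' hk (tendsto_const_nhds (x := b)))).smul hβ).sub_const
        ((μ * (K ⬝ᵥ b)) • b)
    have h3 := h1.norm.add (h2.norm.const_mul (C * ‖K ⬝ᵥ y‖))
    simp only [norm_zero, mul_zero, add_zero] at h3
    have := eventually_prod_principal_iff.1 (h3.eventually (eventually_le_nhds hη))
    filter_upwards [this] with j hj θ hθ
    refine le_trans ?_ (hj θ hθ)
    refine (norm_sub_le _ _).trans ?_
    rw [norm_smul, norm_mul]
    gcongr
    exact hC θ hθ
  rw [Metric.tendsto_atTop']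
  intro ρ hρ
  obtain ⟨η, hη0, hη⟩ : ∃ η > 0, gronwallBound 0 L η 1 < ρ := by
    have h := (gronwallBound_continuous_ε 0 L 1).tendsto 0
    rw [gronwallBound_ε0_δ0] at h
    have := (h.eventually (gt_mem_nhds hρ)).filter_mono (nhdsWithin_le_nhds (s := Ioi 0))
    obtain ⟨η, h1, h2⟩ := (this.and self_mem_nhdsWithin).exists
    exact ⟨η, h2, h1⟩
  obtain ⟨N, hN⟩ := eventually_atTop.1 (hLip.and (hdefect η hη0))
  refine ⟨N, fun j hj => ?_⟩
  obtain ⟨hLj, hDj⟩ := hN j hj.le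
  set e : ℝ → Fin n → ℂ := fun θ => R j θ - (Φ θ * (K ⬝ᵥ y)) • b with he
  have he' : ∀ θ ∈ Icc (0 : ℝ) 1, HasDerivWithinAt e
      (-(μs j * (ks j θ ⬝ᵥ e θ)) • βs j θ + D j θ) (Icc 0 1) θ := by
    intro θ hθ
    have hΦ' := (((hasDerivAt_impulseResponse (K ⬝ᵥ b) μ θ).mul_const (K ⬝ᵥ y)).smul_const
      b).hasDerivWithinAt (s := Icc (0 : ℝ) 1)
    refine ((hR j θ hθ).sub hΦ').congr_deriv ?_
    simp only [he, hD, hΦ, dotProduct_sub, dotProduct_smul, smul_eq_mul]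
    module
  have hbound := norm_le_gronwallBound_of_norm_deriv_right_le (f := e)
    (f' := fun θ => -(μs j * (ks j θ ⬝ᵥ e θ)) • βs j θ + D j θ) (δ := 0) (K := L) (ε := η)
    (a := 0) (b := 1) (fun θ hθ => (he' θ hθ).continuousWithinAt)
    (fun θ hθ => (he' θ (Ico_subset_Icc_self hθ)).mono_of_mem_nhdsWithin
      (Icc_mem_nhdsGE_of_mem hθ))
    (by simp [he, hR0, hΦ, impulseResponse_zero]) (fun θ hθ => by
      have hθ' := Ico_subset_Icc_self hθ
      refine (norm_add_le _ _).trans (add_le_add ?_ (hDj θ hθ'))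
      rw [norm_smul, norm_neg, norm_mul]
      calc ‖μs j‖ * ‖ks j θ ⬝ᵥ e θ‖ * ‖βs j θ‖
          ≤ ‖μs j‖ * (n * ‖ks j θ‖ * ‖e θ‖) * ‖βs j θ‖ := by
            gcongr
            exact norm_dotProduct_le _ _
        _ = n * (‖μs j‖ * ‖ks j θ‖ * ‖βs j θ‖) * ‖e θ‖ := by ring
        _ ≤ L * ‖e θ‖ := by
            gcongr
            exact hLj θ hθ') 1 (by simp)
  rw [sub_zero] at hbound
  rw [dist_eq_norm]
  exact hbound.trans_lt hη

/-- For `λ` outside the open unit disc, `μ = (λ - 1) / (λ - 1 + ε)` lies almost in the disc with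
diameter `[0, 1]`. -/
theorem feedback_factor_bound {ε : ℝ} (hε0 : 0 < ε) {lam : ℂ} (hlam : 1 ≤ ‖lam‖) :
    (1 - ε / 2) * ‖(lam - 1) / (lam - 1 + ε)‖ ^ 2 ≤ ((lam - 1) / (lam - 1 + ε)).re := by
  have h1 : 1 ≤ lam.re ^ 2 + lam.im ^ 2 := by
    have := Complex.sq_norm lam
    rw [Complex.normSq_apply] at this
    nlinarith
  rw [Complex.sq_norm, Complex.normSq_div, Complex.div_re]
  rw [mul_div_assoc', ← add_div]
  refine div_le_div_of_nonneg_right ?_ (Complex.normSq_nonneg _)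
  simp only [Complex.normSq_apply, Complex.sub_re, Complex.one_re, Complex.sub_im, Complex.one_im,
    Complex.add_re, Complex.ofReal_re, Complex.add_im, Complex.ofReal_im]
  nlinarith

theorem feedback_factor_ne {ε : ℝ} (hε0 : 0 < ε) (hε1 : ε < 1) {lam : ℂ} (hlam : 1 ≤ ‖lam‖) :
    lam - 1 + ε ≠ 0 := by
  intro h
  have h1 : lam = ((1 - ε : ℝ) : ℂ) := by
    push_cast
    linear_combination h
  rw [h1, Complex.norm_real, Real.norm_eq_abs, abs_of_pos (by linarith)] at hlam
  linarith

/-- There is no Floquet multiplier `λ` outside the open unit disc, in coordinates that reduce the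
delay equation to one impulse. Here `P` is the monodromy matrix without control, `w` a left
eigenvector of it for the eigenvalue `1`, and `β`, `k` are the input and the gain in the
coordinates moving with the uncontrolled flow. With `μ = (λ - 1) / (λ - 1 + ε)`, a solution with
multiplier `λ` that starts at `y` is at `y - μ R(θ)` during the impulse, `0 ≤ θ ≤ 1`, and ends at
`P (y - μ R(1))`. For `λ ≠ 1` the last equation follows from the one before. For `λ = 1`, where
`μ = 0`, the conditions are those imposed on `R` by a generalised eigenvector of order two. -/
def ExcludesUnstable {n : ℕ} (P : Matrix (Fin n) (Fin n) ℂ) (w : Fin n → ℂ)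
    (β k : ℝ → Fin n → ℂ) (ε δ : ℝ) : Prop :=
  ∀ (lam : ℂ) (y : Fin n → ℂ) (R : ℝ → Fin n → ℂ), 1 ≤ ‖lam‖ → y ≠ 0 → R 0 = 0 →
    (∀ θ ∈ Icc (0 : ℝ) 1, HasDerivWithinAt R
      ((k (δ * θ) ⬝ᵥ (y - ((lam - 1) / (lam - 1 + ε)) • R θ)) • β (δ * θ)) (Icc 0 1) θ) →
    P *ᵥ (y - ((lam - 1) / (lam - 1 + ε)) • R 1) = lam • y →
    w ⬝ᵥ R 1 = -(lam - 1 + ε) * (w ⬝ᵥ y) → False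

/-- The analytic core: by compactness, unstable multipliers for a sequence `(ε, δ) → 0` would give
an eigenvector `u₀` of a limiting matrix. Either `μ → 1`, and the matrix is the stable closed loop,
or `λ → 1`, and then the equation for `w R(1)` shows that the control does not act on `u₀`, which
again makes it an eigenvector of the closed loop. -/
theorem exists_excludesUnstable {n : ℕ} {T : ℝ} (hT : 0 < T)
    (P : Matrix (Fin n) (Fin n) ℂ) {K w : Fin n → ℂ} {β k : ℝ → Fin n → ℂ} {κ : ℝ} (hκ : 0 < κ)
    (hβ : ContinuousOn β (Icc 0 T)) (hk : ContinuousOn k (Icc 0 T)) (hk0 : k 0 = K)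
    (hKb : K ⬝ᵥ β 0 = κ) (hwb : w ⬝ᵥ β 0 ≠ 0)
    (hstab : ∀ (lam : ℂ) (x : Fin n → ℂ), x ≠ 0 →
      P *ᵥ (x - ((1 - Complex.exp (-κ)) / κ * (K ⬝ᵥ x)) • β 0) = lam • x → ‖lam‖ < 1) :
    ∃ r > 0, r < 1 ∧ r < T ∧ ∀ ε δ : ℝ, 0 < ε → ε < r → 0 < δ → δ < r →
      ExcludesUnstable P w β k ε δ := by
  by_contra hcon
  simp only [ExcludesUnstable] at hcon
  push Not at hcon
  set r : ℕ → ℝ := fun j => min 1 T / (j + 2) with hr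
  have hr0 : ∀ j, 0 < r j := fun j => by positivity
  have hr1 : ∀ j, r j < min 1 T := fun j =>
    div_lt_self (by positivity) (by have : (0 : ℝ) ≤ j := Nat.cast_nonneg j; linarith)
  have hrlim : Tendsto r atTop (𝓝 0) :=
    tendsto_const_nhds.div_atTop
      (tendsto_atTop_add_const_right _ _ tendsto_natCast_atTop_atTop)
  choose ε δ hε0 hεr hδ0 hδr lam y R hlam hy hR0 hR hP hw using fun j =>
    hcon (r j) (hr0 j) ((hr1 j).trans_le (min_le_left _ _)) ((hr1 j).trans_le (min_le_right _ _))
  have hεlim : Tendsto ε atTop (𝓝 0) :=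
    tendsto_of_tendsto_of_tendsto_of_le_of_le tendsto_const_nhds hrlim (fun j => (hε0 j).le)
      (fun j => (hεr j).le)
  have hδlim : Tendsto δ atTop (𝓝 0) :=
    tendsto_of_tendsto_of_tendsto_of_le_of_le tendsto_const_nhds hrlim (fun j => (hδ0 j).le)
      (fun j => (hδr j).le)
  set μ : ℕ → ℂ := fun j => (lam j - 1) / (lam j - 1 + ε j) with hμ
  have hε1 : ∀ j, ε j < 1 := fun j => (hεr j).trans ((hr1 j).trans_le (min_le_left _ _))
  have hμre : ∀ j, (1 - ε j / 2) * ‖μ j‖ ^ 2 ≤ (μ j).re := fun j =>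
    feedback_factor_bound (hε0 j) (hlam j)
  have hμ2 : ∀ j, μ j ∈ Metric.closedBall (0 : ℂ) 2 := fun j => by
    rw [mem_closedBall_zero_iff]
    have h1 := hμre j
    have h2 := (Complex.re_le_norm (μ j))
    have h3 := hε1 j
    by_contra! h
    nlinarith [norm_nonneg (μ j)]
  -- Normalise the initial values and pass to a convergent subsequence.
  set u : ℕ → Fin n → ℂ := fun j => ((‖y j‖ : ℂ)⁻¹) • y j with hu
  have hu1 : ∀ j, u j ∈ Metric.sphere (0 : Fin n → ℂ) 1 := fun j => by
    have := norm_ne_zero_iff.2 (hy j)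
    simp [hu, norm_smul, this]
  obtain ⟨⟨u₀, μ₀⟩, hmem, φ, hφ, hlim⟩ :=
    ((isCompact_sphere (0 : Fin n → ℂ) 1).prod
      (isCompact_closedBall (0 : ℂ) 2)).tendsto_subseq (x := fun j => (u j, μ j))
      (fun j => ⟨hu1 j, hμ2 j⟩)
  have hulim : Tendsto (fun j => u (φ j)) atTop (𝓝 u₀) := (continuous_fst.tendsto _).comp hlim
  have hμlim : Tendsto (fun j => μ (φ j)) atTop (𝓝 μ₀) := (continuous_snd.tendsto _).comp hlim
  have hφt := hφ.tendsto_atTop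
  have hu₀ : u₀ ≠ 0 := by
    have : ‖u₀‖ = 1 := by simpa using hmem.1
    rw [← norm_ne_zero_iff, this]
    exact one_ne_zero
  have hμ₀ : ‖μ₀‖ ^ 2 ≤ μ₀.re := by
    have h1 : Tendsto (fun j => (1 - ε (φ j) / 2) * ‖μ (φ j)‖ ^ 2) atTop
        (𝓝 ((1 - 0 / 2) * ‖μ₀‖ ^ 2)) :=
      ((((hεlim.comp hφt).div_const 2).const_sub 1)).mul (hμlim.norm.pow 2)
    have h2 := le_of_tendsto_of_tendsto' h1 ((Complex.continuous_re.tendsto _).comp hμlim)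
      (fun j => hμre (φ j))
    simpa using h2
  set S : ℕ → ℝ → Fin n → ℂ := fun j θ => ((‖y (φ j)‖ : ℂ)⁻¹) • R (φ j) θ with hS
  -- Over the impulse the coefficients converge uniformly to their values at time `0`.
  have hunif : ∀ g : ℝ → Fin n → ℂ, ContinuousOn g (Icc 0 T) →
      Tendsto (fun p : ℕ × ℝ => g (δ (φ p.1) * p.2)) (atTop ×ˢ 𝓟 (Icc 0 1)) (𝓝 (g 0)) := by
    intro g hg
    refine (hg 0 ⟨le_rfl, hT.le⟩).tendsto.comp (tendsto_nhdsWithin_iff.2 ⟨?_, ?_⟩)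
    · rw [Metric.tendsto_nhds]
      intro η hη
      refine eventually_prod_principal_iff.2 ?_
      filter_upwards [(hδlim.comp hφt).eventually (gt_mem_nhds hη)] with j hj θ hθ
      have h1 := hδ0 (φ j)
      have : δ (φ j) < η := hj
      rw [Real.dist_eq, sub_zero, abs_of_nonneg (mul_nonneg h1.le hθ.1)]
      nlinarith [hθ.1, hθ.2]
    · refine eventually_prod_principal_iff.2 (Eventually.of_forall fun j θ hθ => ?_)
      have h1 := hδ0 (φ j)
      have h2 := (hδr (φ j)).trans ((hr1 (φ j)).trans_le (min_le_right _ _))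
      exact ⟨mul_nonneg h1.le hθ.1, by nlinarith [hθ.1, hθ.2]⟩
  have hSlim := tendsto_rank_one_ode (βs := fun j θ => β (δ (φ j) * θ))
    (ks := fun j θ => k (δ (φ j) * θ)) (hunif β hβ) (hk0 ▸ hunif k hk) hulim hμlim
    (R := S) (fun j => by simp [hS, hR0]) (fun j θ hθ => by
      refine ((hR (φ j) θ hθ).const_smul ((‖y (φ j)‖ : ℂ)⁻¹)).congr_deriv ?_
      simp only [hS, hu, hμ, dotProduct_sub, dotProduct_smul, smul_eq_mul]
      module)
  rw [hKb] at hSlim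
  set q := impulseResponse κ μ₀ 1 with hq
  have hq0 : q ≠ 0 := impulseResponse_one_ne_zero hκ hμ₀
  -- The eigenvalue equation in the limit.
  have hPS : ∀ j, P *ᵥ (u (φ j) - μ (φ j) • S j 1) = lam (φ j) • u (φ j) := fun j => by
    have := congrArg (((‖y (φ j)‖ : ℂ)⁻¹) • ·) (hP (φ j))
    simp only [← Matrix.mulVec_smul] at this
    simp only [hS, hu]
    rw [smul_comm (lam (φ j)), ← this]
    congr 1
    rw [smul_sub]
    simp only [hμ]
    module
  have hPlim : Tendsto (fun j => lam (φ j) • u (φ j)) atTop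
      (𝓝 (P *ᵥ (u₀ - μ₀ • ((q * (K ⬝ᵥ u₀)) • β 0)))) := by
    have hc : Continuous fun x : Fin n → ℂ => P *ᵥ x := Continuous.matrix_mulVec
      continuous_const continuous_id
    have := (hc.tendsto _).comp (hulim.sub (hμlim.smul hSlim))
    exact this.congr fun j => hPS j
  obtain ⟨i, hi⟩ := Function.ne_iff.1 hu₀
  obtain ⟨lam₀, hlamlim⟩ : ∃ l, Tendsto (fun j => lam (φ j)) atTop (𝓝 l) := by
    have h1 := tendsto_pi_nhds.1 hPlim i
    have h2 := tendsto_pi_nhds.1 hulim i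
    refine ⟨_, (h1.div h2 hi).congr' ?_⟩
    filter_upwards [h2.eventually_ne hi] with j hj
    simp only [Pi.smul_apply, smul_eq_mul, Pi.div_apply]
    exact mul_div_cancel_right₀ _ hj
  have hlim_eq := tendsto_nhds_unique hPlim (hlamlim.smul hulim)
  have hlam₀ : 1 ≤ ‖lam₀‖ := ge_of_tendsto' hlamlim.norm fun j => hlam (φ j)
  have hden : Tendsto (fun j => lam (φ j) - 1 + (ε (φ j) : ℂ)) atTop (𝓝 (lam₀ - 1)) := by
    have h := (Complex.continuous_ofReal.tendsto 0).comp (hεlim.comp hφt)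
    simpa using (hlamlim.sub_const 1).add h
  by_cases h1 : lam₀ = 1
  · -- Pairing with `w` forces `K u₀ = 0`, so the closed loop has the eigenvalue `1`.
    have hwS : Tendsto (fun j => w ⬝ᵥ S j 1) atTop (𝓝 (w ⬝ᵥ ((q * (K ⬝ᵥ u₀)) • β 0))) := by
      have hc : Continuous fun x : Fin n → ℂ => w ⬝ᵥ x := by unfold dotProduct; fun_prop
      exact (hc.tendsto _).comp hSlim
    have hw0 : Tendsto (fun j => w ⬝ᵥ S j 1) atTop (𝓝 0) := by
      have hc : Continuous fun x : Fin n → ℂ => w ⬝ᵥ x := by unfold dotProduct; fun_prop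
      have h2 := hden.neg.mul ((hc.tendsto _).comp hulim)
      rw [h1, sub_self, neg_zero, zero_mul] at h2
      refine h2.congr fun j => ?_
      simp only [Function.comp, hS, hu, dotProduct_smul, smul_eq_mul, (hw _).1]
      ring
    have h3 := tendsto_nhds_unique hwS hw0
    rw [dotProduct_smul, smul_eq_mul] at h3
    have hKu : K ⬝ᵥ u₀ = 0 := by
      simpa [hq0, hwb] using h3
    have := hstab 1 u₀ hu₀ (by simpa [hKu, h1] using hlim_eq)
    simp at this
  · have hμ1 : μ₀ = 1 := by
      have h2 := (hlamlim.sub_const 1).div hden (sub_ne_zero.2 h1)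
      rw [div_self (sub_ne_zero.2 h1)] at h2
      exact tendsto_nhds_unique hμlim h2
    refine absurd (hstab lam₀ u₀ hu₀ ?_) (not_lt.2 hlam₀)
    rw [← hlim_eq, hμ1, one_smul, hq, hμ1, impulseResponse]
    simp [hκ.ne']

/-! ### Linear systems with an impulsive input -/

theorem norm_mulVec_le {n : ℕ} (A : Matrix (Fin n) (Fin n) ℂ) {a : ℝ}
    (ha : ∀ i, ‖A i‖ ≤ a) (x : Fin n → ℂ) (ha0 : 0 ≤ a) : ‖A *ᵥ x‖ ≤ n * a * ‖x‖ := by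
  refine (pi_norm_le_iff_of_nonneg (by positivity)).2 fun i => ?_
  refine (norm_dotProduct_le _ _).trans ?_
  gcongr
  exact ha i

theorem exists_row_bound {n : ℕ} {A : ℝ → Matrix (Fin n) (Fin n) ℂ} (hA : Continuous A) (T : ℝ) :
    ∃ a, 0 ≤ a ∧ ∀ t ∈ Icc 0 T, ∀ i, ‖A t i‖ ≤ a := by
  have hA' : Continuous fun t => (fun i => A t i : Fin n → Fin n → ℂ) := hA
  obtain ⟨a, ha⟩ := (isCompact_Icc (a := (0 : ℝ)) (b := T)).exists_bound_of_continuousOn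
    hA'.continuousOn
  exact ⟨max a 0, le_max_right _ _, fun t ht i =>
    (norm_le_pi_norm (fun i => A t i) i).trans ((ha t ht).trans (le_max_left _ _))⟩

/-- Global solutions of `x' = A(t) x`. -/
theorem exists_linear_solution {n : ℕ} {A : ℝ → Matrix (Fin n) (Fin n) ℂ} (hA : Continuous A)
    {T : ℝ} (hT : 0 ≤ T) (x₀ : Fin n → ℂ) :
    ∃ x : ℝ → Fin n → ℂ, x 0 = x₀ ∧
      ∀ t ∈ Icc 0 T, HasDerivWithinAt x (A t *ᵥ x t) (Icc 0 T) t := by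
  obtain ⟨a, ha0, ha⟩ := exists_row_bound hA T
  obtain ⟨x, hxc, hx, -⟩ := exists_unique_volterra hT (fun t x => A t *ᵥ x) (n * a)
    (by positivity) (fun t ht x y => by
      rw [← Matrix.mulVec_sub]
      exact norm_mulVec_le _ (ha t ht) _ ha0)
    (fun x hx => (hA.matrix_mulVec hx).intervalIntegrable _ _) x₀
  refine ⟨x, by simpa using hx 0 ⟨le_rfl, hT⟩, fun t ht => ?_⟩
  exact hasDerivWithinAt_of_eq_integral hT (hA.matrix_mulVec hxc).continuousOn hx ht

theorem hasDerivWithinAt_mulVec {n : ℕ} {Z : ℝ → Matrix (Fin n) (Fin n) ℂ}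
    {Z' : Matrix (Fin n) (Fin n) ℂ} {x : ℝ → Fin n → ℂ} {x' : Fin n → ℂ} {s : Set ℝ} {t : ℝ}
    (hZ : ∀ i j, HasDerivWithinAt (fun r => Z r i j) (Z' i j) s t)
    (hx : HasDerivWithinAt x x' s t) :
    HasDerivWithinAt (fun r => Z r *ᵥ x r) (Z' *ᵥ x t + Z t *ᵥ x') s t := by
  rw [hasDerivWithinAt_pi] at hx ⊢
  intro i
  refine (HasDerivWithinAt.fun_sum (u := Finset.univ) fun j _ =>
    (hZ i j).mul (hx j)).congr_deriv ?_
  rw [Finset.sum_add_distrib]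
  rfl

theorem continuousOn_matrix_of_hasDerivWithinAt {n : ℕ} {Z Z' : ℝ → Matrix (Fin n) (Fin n) ℂ}
    {s : Set ℝ} (hZ : ∀ t ∈ s, ∀ i j, HasDerivWithinAt (fun r => Z r i j) (Z' t i j) s t) :
    ContinuousOn Z s :=
  continuousOn_pi.2 fun i => continuousOn_pi.2 fun j => fun t ht =>
    (hZ t ht i j).continuousWithinAt

theorem continuousOn_mulVec {n : ℕ} {Z : ℝ → Matrix (Fin n) (Fin n) ℂ} {x : ℝ → Fin n → ℂ}
    {s : Set ℝ} (hZ : ContinuousOn Z s) (hx : ContinuousOn x s) :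
    ContinuousOn (fun t => Z t *ᵥ x t) s := by
  have hc : Continuous fun p : Matrix (Fin n) (Fin n) ℂ × (Fin n → ℂ) => p.1 *ᵥ p.2 :=
    continuous_fst.matrix_mulVec continuous_snd
  exact hc.comp_continuousOn (hZ.prodMk hx)

theorem eq_left_of_hasDerivWithinAt_zero {n : ℕ} {a b : ℝ} {x : ℝ → Fin n → ℂ}
    (hx : ∀ t ∈ Icc a b, HasDerivWithinAt x 0 (Icc a b) t) {t : ℝ} (ht : t ∈ Icc a b) :
    x t = x a := by
  simpa using eq_integral_of_hasDerivWithinAt (g := fun _ => 0) continuousOn_const hx ht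

/-- A fundamental matrix `Y` of `x' = A x` is inverted by the solution of the adjoint equation
`Z' = -Z A`. -/
theorem exists_inverse_fundamental {n : ℕ} {A : ℝ → Matrix (Fin n) (Fin n) ℂ} (hA : Continuous A)
    {T : ℝ} (hT : 0 ≤ T) {Y : ℝ → Matrix (Fin n) (Fin n) ℂ} (hY0 : Y 0 = 1)
    (hY : ∀ t ∈ Icc 0 T, ∀ i j,
      HasDerivWithinAt (fun r => Y r i j) ((A t * Y t) i j) (Icc 0 T) t) :
    ∃ Z : ℝ → Matrix (Fin n) (Fin n) ℂ, Z 0 = 1 ∧ (∀ t ∈ Icc 0 T, Z t * Y t = 1) ∧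
      ∀ t ∈ Icc 0 T, ∀ i j,
        HasDerivWithinAt (fun r => Z r i j) ((-(Z t * A t)) i j) (Icc 0 T) t := by
  choose x hx0 hx using fun i : Fin n =>
    exists_linear_solution (A := fun t => -(A t)ᵀ) hA.matrix_transpose.neg hT
      ((1 : Matrix (Fin n) (Fin n) ℂ) i)
  have hZ : ∀ t ∈ Icc 0 T, ∀ i j, HasDerivWithinAt (fun r => Matrix.of (fun i => x i r) i j)
      ((-(Matrix.of (fun i => x i t) * A t)) i j) (Icc 0 T) t := fun t ht i j => by
    refine ((hasDerivWithinAt_pi.1 (hx i t ht)) j).congr_deriv ?_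
    rw [Matrix.neg_mulVec, Matrix.mulVec_transpose]
    rfl
  have hZ0 : (Matrix.of fun i => x i 0) = (1 : Matrix (Fin n) (Fin n) ℂ) := by
    ext i j
    simp [hx0]
  refine ⟨fun t => Matrix.of fun i => x i t, hZ0, fun t ht => ?_, hZ⟩
  ext i j
  have hcol : ∀ t ∈ Icc 0 T, HasDerivWithinAt
      (fun r => (Matrix.of fun i => x i r) *ᵥ fun k => Y r k j) 0 (Icc 0 T) t := fun t ht => by
    refine (hasDerivWithinAt_mulVec (hZ t ht)
      (hasDerivWithinAt_pi.2 fun k => hY t ht k j)).congr_deriv ?_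
    have : (fun k => (A t * Y t) k j) = A t *ᵥ fun k => Y t k j := rfl
    rw [this, Matrix.neg_mulVec, Matrix.mulVec_mulVec, neg_add_cancel]
  have h := congrFun (eq_left_of_hasDerivWithinAt_zero hcol ht) i
  rw [hZ0, hY0, Matrix.one_mulVec] at h
  exact h

theorem impulse_of_mem_Icc {T : ℝ} (hT : 0 < T) {δ s : ℝ} (hδ : δ < T) (hs : s ∈ Icc 0 δ) :
    impulse hT δ s = 1 / δ := by
  have : toIcoMod hT 0 s = s := (toIcoMod_eq_self hT).2 ⟨hs.1, by linarith [hs.2]⟩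
  rw [impulse, this, if_pos hs]

theorem impulse_of_mem_Ioo {T : ℝ} (hT : 0 < T) {δ s : ℝ} (hδ : 0 < δ) (hs : s ∈ Ioo δ T) :
    impulse hT δ s = 0 := by
  have : toIcoMod hT 0 s = s :=
    (toIcoMod_eq_self hT).2 ⟨by linarith [hs.1], by linarith [hs.2]⟩
  rw [impulse, this, if_neg fun h => absurd hs.1 (not_lt.2 h.2)]

theorem abs_impulse_le {T : ℝ} (hT : 0 < T) {δ : ℝ} (hδ : 0 < δ) (s : ℝ) :
    |impulse hT δ s| ≤ 1 / δ := by
  rw [impulse]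
  split_ifs
  · rw [abs_of_pos (by positivity)]
  · rw [abs_zero]; positivity

theorem intervalIntegrable_impulse_smul {n : ℕ} {T : ℝ} (hT : 0 < T) {δ : ℝ} (hδ0 : 0 < δ)
    (hδ : δ < T) {u : ℝ → Fin n → ℂ} (hu : ContinuousOn u (Icc 0 T)) :
    IntervalIntegrable (fun s => (impulse hT δ s : ℂ) • u s) volume 0 T := by
  have h1 : IntervalIntegrable (fun s => (impulse hT δ s : ℂ) • u s) volume 0 δ := by
    have hc : ContinuousOn (fun s => ((1 / δ : ℝ) : ℂ) • u s) (uIcc 0 δ) := by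
      rw [uIcc_of_le hδ0.le]
      exact (continuousOn_const (c := ((1 / δ : ℝ) : ℂ))).smul
        (hu.mono (Icc_subset_Icc_right hδ.le))
    refine hc.intervalIntegrable.congr_uIoo fun s hs => ?_
    rw [uIoo_of_le hδ0.le] at hs
    simp only [impulse_of_mem_Icc hT hδ (Ioo_subset_Icc_self hs)]
  have h2 : IntervalIntegrable (fun s => (impulse hT δ s : ℂ) • u s) volume δ T := by
    refine IntervalIntegrable.congr_uIoo (f := fun _ => 0) intervalIntegrable_const ?_
    intro s hs
    rw [uIoo_of_le hδ.le] at hs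
    simp [impulse_of_mem_Ioo hT hδ0 hs]
  exact h1.trans h2

/-- Variation of constants for the impulsive input `Δ_δ c b`: in the coordinates `X = Y⁻¹ x`, and
in the time `θ = t / δ`, the impulse acts during the unit interval, and nothing happens
afterwards. -/
theorem impulsive_variation_of_constants {n : ℕ} {T : ℝ} (hT : 0 < T)
    {A Y Z : ℝ → Matrix (Fin n) (Fin n) ℂ} {b : ℝ → Fin n → ℂ} (hA : Continuous A)
    (hb : Continuous b) (hZ0 : Z 0 = 1) (hZY : ∀ t ∈ Icc 0 T, Z t * Y t = 1)
    (hZ : ∀ t ∈ Icc 0 T, ∀ i j,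
        HasDerivWithinAt (fun r => Z r i j) ((-(Z t * A t)) i j) (Icc 0 T) t)
    {δ : ℝ} (hδ0 : 0 < δ) (hδ : δ < T) {x : ℝ → Fin n → ℂ} {c : ℝ → ℂ}
    (hxc : ContinuousOn x (Icc 0 T)) (hc : ContinuousOn c (Icc 0 T))
    (hx : ∀ t ∈ Icc 0 T, x t =
      x 0 + ∫ s in (0 : ℝ)..t, (A s *ᵥ x s + ((impulse hT δ s : ℂ) * c s) • b s)) :
    ∃ X : ℝ → Fin n → ℂ, X 0 = x 0 ∧ Y T *ᵥ X 1 = x T ∧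
      (∀ θ ∈ Icc (0 : ℝ) 1, Y (δ * θ) *ᵥ X θ = x (δ * θ)) ∧
      ∀ θ ∈ Icc (0 : ℝ) 1,
        HasDerivWithinAt X (c (δ * θ) • (Z (δ * θ) *ᵥ b (δ * θ))) (Icc 0 1) θ := by
  have hYZ : ∀ t ∈ Icc 0 T, Y t * Z t = 1 := fun t ht => mul_eq_one_comm.1 (hZY t ht)
  have hAx : ContinuousOn (fun s => A s *ᵥ x s) (Icc 0 T) :=
    continuousOn_mulVec hA.continuousOn hxc
  have hcb : ContinuousOn (fun s => c s • b s) (Icc 0 T) := hc.smul hb.continuousOn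
  have hsub1 : Icc 0 δ ⊆ Icc 0 T := Icc_subset_Icc_right hδ.le
  have hsub2 : Icc δ T ⊆ Icc 0 T := Icc_subset_Icc_left hδ0.le
  have hδmem : δ ∈ Icc 0 T := ⟨hδ0.le, hδ.le⟩
  have hint : ∀ t ∈ Icc 0 T, IntervalIntegrable
      (fun s => A s *ᵥ x s + ((impulse hT δ s : ℂ) * c s) • b s) volume 0 t := fun t ht => by
    have h1 : IntervalIntegrable (fun s => A s *ᵥ x s) volume 0 T :=
      ContinuousOn.intervalIntegrable (by rwa [uIcc_of_le hT.le])
    have h2 := h1.add (intervalIntegrable_impulse_smul hT hδ0 hδ hcb)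
    refine IntervalIntegrable.mono_set (b := T) (a := 0) ?_ ?_
    · simpa only [smul_smul] using h2
    · rw [uIcc_of_le ht.1, uIcc_of_le hT.le]
      exact Icc_subset_Icc_right ht.2
  have hd1 : ∀ t ∈ Icc 0 δ, HasDerivWithinAt x
      (A t *ᵥ x t + (((1 / δ : ℝ) : ℂ) * c t) • b t) (Icc 0 δ) t := fun t ht => by
    refine hasDerivWithinAt_of_eq_integral (x₀ := x 0)
      (g := fun t => A t *ᵥ x t + (((1 / δ : ℝ) : ℂ) * c t) • b t) hδ0.le ?_ ?_ ht
    · exact (hAx.add ((continuousOn_const.mul hc).smul hb.continuousOn)).mono hsub1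
    · intro s hs
      rw [hx s (hsub1 hs)]
      congr 1
      refine intervalIntegral.integral_congr fun r hr => ?_
      rw [uIcc_of_le hs.1] at hr
      simp only [impulse_of_mem_Icc hT hδ ⟨hr.1, hr.2.trans hs.2⟩]
  have hd2 : ∀ t ∈ Icc δ T, HasDerivWithinAt x (A t *ᵥ x t) (Icc δ T) t := fun t ht => by
    refine hasDerivWithinAt_of_eq_integral (x₀ := x δ)
      (g := fun t => A t *ᵥ x t) hδ.le (hAx.mono hsub2) ?_ ht
    intro s hs
    have h1 := hx s (hsub2 hs)
    have h2 := hx δ hδmem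
    have h3 := intervalIntegral.integral_interval_sub_left (hint s (hsub2 hs)) (hint δ hδmem)
    have h4 : ∫ r in δ..s, (A r *ᵥ x r + ((impulse hT δ r : ℂ) * c r) • b r) =
        ∫ r in δ..s, A r *ᵥ x r :=
      intervalIntegral.integral_congr_Ioo_of_le hs.1 fun r hr => by
        simp [impulse_of_mem_Ioo hT hδ0 ⟨hr.1, hr.2.trans_le hs.2⟩]
    rw [← h4, ← h3, h1, h2]
    abel
  have hW1 : ∀ t ∈ Icc 0 δ, HasDerivWithinAt (fun r => Z r *ᵥ x r)
      ((((1 / δ : ℝ) : ℂ) * c t) • (Z t *ᵥ b t)) (Icc 0 δ) t := fun t ht => by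
    refine (hasDerivWithinAt_mulVec (fun i j => (hZ t (hsub1 ht) i j).mono hsub1)
      (hd1 t ht)).congr_deriv ?_
    rw [Matrix.mulVec_add, Matrix.neg_mulVec, Matrix.mulVec_mulVec, Matrix.mulVec_smul]
    abel
  have hW2 : ∀ t ∈ Icc δ T, HasDerivWithinAt (fun r => Z r *ᵥ x r) 0 (Icc δ T) t :=
    fun t ht => by
    refine (hasDerivWithinAt_mulVec (fun i j => (hZ t (hsub2 ht) i j).mono hsub2)
      (hd2 t ht)).congr_deriv ?_
    rw [Matrix.neg_mulVec, Matrix.mulVec_mulVec, neg_add_cancel]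
  have hmaps : MapsTo (fun θ : ℝ => δ * θ) (Icc 0 1) (Icc 0 δ) := fun θ hθ =>
    ⟨mul_nonneg hδ0.le hθ.1, mul_le_of_le_one_right hδ0.le hθ.2⟩
  refine ⟨fun θ => Z (δ * θ) *ᵥ x (δ * θ), by simp [hZ0], ?_, fun θ hθ => ?_, fun θ hθ => ?_⟩
  · have h := eq_left_of_hasDerivWithinAt_zero hW2 (right_mem_Icc.2 hδ.le)
    simp only [mul_one]
    rw [← h, Matrix.mulVec_mulVec, hYZ T ⟨hT.le, le_rfl⟩, Matrix.one_mulVec]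
  · rw [Matrix.mulVec_mulVec, hYZ _ (hsub1 (hmaps hθ)), Matrix.one_mulVec]
  · have h2 : HasDerivWithinAt (fun θ : ℝ => δ * θ) δ (Icc 0 1) θ := by
      simpa using ((hasDerivAt_id θ).const_mul δ).hasDerivWithinAt (s := Icc (0 : ℝ) 1)
    refine ((hW1 _ (hmaps hθ)).scomp θ h2 hmaps).congr_deriv ?_
    rw [← Complex.coe_smul, smul_smul, ← mul_assoc, ← Complex.ofReal_mul,
      mul_one_div_cancel hδ0.ne', Complex.ofReal_one, one_mul]

/-- Existence and uniqueness for the linear equation with impulsive feedback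
`x' = A x + Δ_δ K (g + ρ x) b` in integrated form. -/
theorem exists_unique_impulsive {n : ℕ} {T : ℝ} (hT : 0 < T)
    {A : ℝ → Matrix (Fin n) (Fin n) ℂ} {b g : ℝ → Fin n → ℂ} (hA : Continuous A)
    (hb : Continuous b) (hg : Continuous g) (K : Fin n → ℂ) (ρ : ℂ) {δ : ℝ} (hδ0 : 0 < δ)
    (hδ : δ < T) (x₀ : Fin n → ℂ) :
    ∃ x : ℝ → Fin n → ℂ, Continuous x ∧
      (∀ t ∈ Icc 0 T, x t = x₀ + ∫ s in (0 : ℝ)..t,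
        (A s *ᵥ x s + ((impulse hT δ s : ℂ) * (K ⬝ᵥ (g s + ρ • x s))) • b s)) ∧
      ∀ y : ℝ → Fin n → ℂ, ContinuousOn y (Icc 0 T) →
        (∀ t ∈ Icc 0 T, y t = x₀ + ∫ s in (0 : ℝ)..t,
          (A s *ᵥ y s + ((impulse hT δ s : ℂ) * (K ⬝ᵥ (g s + ρ • y s))) • b s)) →
        EqOn y x (Icc 0 T) := by
  obtain ⟨a, ha0, ha⟩ := exists_row_bound hA T
  obtain ⟨B, hB⟩ := (isCompact_Icc (a := (0 : ℝ)) (b := T)).exists_bound_of_continuousOn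
    hb.continuousOn
  have hB0 : 0 ≤ B := (norm_nonneg _).trans (hB 0 ⟨le_rfl, hT.le⟩)
  refine exists_unique_volterra hT.le
    (fun s x => A s *ᵥ x + ((impulse hT δ s : ℂ) * (K ⬝ᵥ (g s + ρ • x))) • b s)
    (n * a + 1 / δ * (n * ‖K‖ * ‖ρ‖) * B) (by positivity) ?_ ?_ x₀
  · intro t ht x y
    have h : A t *ᵥ x + ((impulse hT δ t : ℂ) * (K ⬝ᵥ (g t + ρ • x))) • b t -
        (A t *ᵥ y + ((impulse hT δ t : ℂ) * (K ⬝ᵥ (g t + ρ • y))) • b t) =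
        A t *ᵥ (x - y) + ((impulse hT δ t : ℂ) * (K ⬝ᵥ (ρ • (x - y)))) • b t := by
      simp only [Matrix.mulVec_sub, dotProduct_add, smul_sub, dotProduct_sub]
      module
    rw [h, add_mul]
    refine (norm_add_le _ _).trans (add_le_add (norm_mulVec_le _ (ha t ht) _ ha0) ?_)
    rw [norm_smul, norm_mul, Complex.norm_real, Real.norm_eq_abs]
    calc |impulse hT δ t| * ‖K ⬝ᵥ (ρ • (x - y))‖ * ‖b t‖
        ≤ 1 / δ * (n * ‖K‖ * ‖ρ • (x - y)‖) * B := by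
          gcongr
          · exact abs_impulse_le hT hδ0 t
          · exact norm_dotProduct_le _ _
          · exact hB t ht
      _ = _ := by rw [norm_smul]; ring
  · intro x hx
    have hKc : Continuous fun s => K ⬝ᵥ (g s + ρ • x s) :=
      continuous_const.dotProduct (hg.add (hx.const_smul ρ))
    have h1 := ((hA.matrix_mulVec hx).intervalIntegrable (μ := volume) 0 T).add
      (intervalIntegrable_impulse_smul hT hδ0 hδ (hKc.smul hb).continuousOn)
    simpa only [smul_smul, Pi.smul_apply'] using h1

/-! ### Linearisation along the periodic orbit -/

section Linearization

variable {n : ℕ} {f : (Fin n → ℝ) × ℝ → (Fin n → ℝ)} {T : ℝ} {xs : ℝ → Fin n → ℝ}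

theorem jacX_mulVec (hf : ContDiff ℝ ∞ f) (t : ℝ) (a : Fin n → ℝ) :
    jacX f xs t *ᵥ a = fderiv ℝ f (xs t, 0) (a, 0) := by
  have h1 : HasFDerivAt f (fderiv ℝ f (xs t, 0)) (xs t, 0) :=
    (hf.differentiable (by simp) _).hasFDerivAt
  have h2 : HasFDerivAt (fun x : Fin n → ℝ => (x, (0 : ℝ)))
      (ContinuousLinearMap.inl ℝ (Fin n → ℝ) ℝ) (xs t) :=
    (ContinuousLinearMap.inl ℝ (Fin n → ℝ) ℝ).hasFDerivAt
  have h3 : HasFDerivAt (fun x : Fin n → ℝ => f (x, 0))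
      ((fderiv ℝ f (xs t, 0)).comp (ContinuousLinearMap.inl ℝ (Fin n → ℝ) ℝ)) (xs t) :=
    HasFDerivAt.comp (xs t) h1 h2
  rw [jacX, LinearMap.toMatrix'_mulVec, h3.fderiv]
  simp

theorem jacU_eq (hf : ContDiff ℝ ∞ f) (t : ℝ) : jacU f xs t = fderiv ℝ f (xs t, 0) (0, 1) := by
  have h1 : HasFDerivAt f (fderiv ℝ f (xs t, 0)) (xs t, 0) :=
    (hf.differentiable (by simp) _).hasFDerivAt
  have h2 : HasDerivAt (fun u : ℝ => (xs t, u)) ((0 : Fin n → ℝ), (1 : ℝ)) 0 :=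
    (hasDerivAt_const _ _).prodMk (hasDerivAt_id _)
  exact (h1.comp_hasDerivAt (0 : ℝ) h2).deriv

theorem continuous_fderiv_along (hf : ContDiff ℝ ∞ f) (hxs : IsPeriodicOrbit f T xs) :
    Continuous fun t => fderiv ℝ f (xs t, 0) := by
  have h : Continuous xs := continuous_iff_continuousAt.2 fun t => (hxs.solves t).continuousAt
  exact (hf.continuous_fderiv (by simp)).comp (h.prodMk continuous_const)

theorem continuous_jacX (hf : ContDiff ℝ ∞ f) (hxs : IsPeriodicOrbit f T xs) :
    Continuous (jacX f xs) := by
  refine continuous_matrix fun i j => ?_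
  have h : ∀ t, jacX f xs t i j = fderiv ℝ f (xs t, 0) (Pi.single j 1, 0) i := fun t => by
    rw [← jacX_mulVec hf, Matrix.mulVec_single_one]
    rfl
  simp only [h]
  have := (continuous_fderiv_along hf hxs).clm_apply
    (continuous_const (y := ((Pi.single j 1 : Fin n → ℝ), (0 : ℝ))))
  exact (continuous_apply i).comp this

theorem continuous_jacU (hf : ContDiff ℝ ∞ f) (hxs : IsPeriodicOrbit f T xs) :
    Continuous (jacU f xs) := by
  have h : jacU f xs = fun t => fderiv ℝ f (xs t, 0) (0, 1) := funext (jacU_eq hf)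
  rw [h]
  exact (continuous_fderiv_along hf hxs).clm_apply continuous_const

theorem continuous_cmat_jacX (hf : ContDiff ℝ ∞ f) (hxs : IsPeriodicOrbit f T xs) :
    Continuous fun t => cmat (jacX f xs t) :=
  (continuous_jacX hf hxs).matrix_map Complex.continuous_ofReal

theorem continuous_cvec_jacU (hf : ContDiff ℝ ∞ f) (hxs : IsPeriodicOrbit f T xs) :
    Continuous fun t => cvec (jacU f xs t) :=
  continuous_pi fun i =>
    Complex.continuous_ofReal.comp ((continuous_apply i).comp (continuous_jacU hf hxs))

theorem fderiv_controlledField (hf : ContDiff ℝ ∞ f) (hT : 0 < T) (δ : ℝ) (K : Fin n → ℝ)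
    (t : ℝ) (a c : Fin n → ℝ) :
    fderiv ℝ (controlledField f hT δ K t) (xs t, xs t) (a, c) =
      jacX f xs t *ᵥ a + (impulse hT δ t * (K ⬝ᵥ (c - a))) • jacU f xs t := by
  set g : (Fin n → ℝ) × (Fin n → ℝ) →ₗ[ℝ] (Fin n → ℝ) × ℝ :=
    { toFun := fun p => (p.1, impulse hT δ t * (K ⬝ᵥ (p.2 - p.1)))
      map_add' := fun p q => by
        ext
        · simp
        · simp [dotProduct_add, dotProduct_sub]; ring
      map_smul' := fun r p => by
        ext
        · simp
        · simp [dotProduct_sub]; ring } with hg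
  have hgd : HasFDerivAt (LinearMap.toContinuousLinearMap g) (LinearMap.toContinuousLinearMap g)
      (xs t, xs t) := ContinuousLinearMap.hasFDerivAt _
  have hval : LinearMap.toContinuousLinearMap g (xs t, xs t) = (xs t, 0) := by simp [hg]
  have h1 : HasFDerivAt f (fderiv ℝ f (xs t, 0))
      (LinearMap.toContinuousLinearMap g (xs t, xs t)) := by
    rw [hval]
    exact (hf.differentiable (by simp) _).hasFDerivAt
  have h2 : HasFDerivAt (controlledField f hT δ K t)
      ((fderiv ℝ f (xs t, 0)).comp (LinearMap.toContinuousLinearMap g)) (xs t, xs t) :=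
    HasFDerivAt.comp (xs t, xs t) h1 hgd
  rw [h2.fderiv, jacX_mulVec hf, jacU_eq hf, ← map_smul, ← map_add]
  simp [hg]

theorem linearizedField_eq (hf : ContDiff ℝ ∞ f) (hT : 0 < T) (δ : ℝ) (K : Fin n → ℝ) (t : ℝ)
    (z : (Fin n → ℂ) × (Fin n → ℂ)) :
    linearizedField f hT xs δ K t z = cmat (jacX f xs t) *ᵥ z.1 +
      ((impulse hT δ t : ℂ) * (cvec K ⬝ᵥ (z.2 - z.1))) • cvec (jacU f xs t) := by
  ext i
  simp only [linearizedField, complexExt, fderiv_controlledField hf]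
  apply Complex.ext <;>
  simp [Matrix.mulVec, dotProduct]

/-- The velocity `f(xs, 0)` of the periodic orbit solves the variational equation. -/
theorem hasDerivAt_velocity (hf : ContDiff ℝ ∞ f) (hxs : IsPeriodicOrbit f T xs) (t : ℝ) :
    HasDerivAt (fun s => f (xs s, 0)) (jacX f xs t *ᵥ f (xs t, 0)) t := by
  rw [jacX_mulVec hf]
  have h1 : HasFDerivAt f (fderiv ℝ f (xs t, 0)) (xs t, 0) :=
    (hf.differentiable (by simp) _).hasFDerivAt
  exact h1.comp_hasDerivAt t ((hxs.solves t).prodMk (hasDerivAt_const t (0 : ℝ)))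

end Linearization

/-! ### The time-`T` map -/

section TimeTMap

variable {n : ℕ} {f : (Fin n → ℝ) × ℝ → (Fin n → ℝ)} {T : ℝ} {xs : ℝ → Fin n → ℝ} {hT : 0 < T}
  {δ ε : ℝ} {K : Fin n → ℝ}

theorem IsLinearizedSolution.continuousOn_fst {p : ℝ → (Fin n → ℂ) × (Fin n → ℂ)}
    (hp : IsLinearizedSolution f hT xs δ ε K p) : ContinuousOn (fun t => (p t).1) (Icc 0 T) :=
  (continuous_fst.comp_continuousOn hp.continuousOn).mono
    (Icc_subset_Icc_left (by linarith))

theorem IsLinearizedSolution.continuousOn_snd {p : ℝ → (Fin n → ℂ) × (Fin n → ℂ)}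
    (hp : IsLinearizedSolution f hT xs δ ε K p) : ContinuousOn (fun t => (p t).2) (Icc 0 T) :=
  (continuous_snd.comp_continuousOn hp.continuousOn).mono
    (Icc_subset_Icc_left (by linarith))

/-- Two solutions with the same history coincide. -/
theorem IsLinearizedSolution.unique (hf : ContDiff ℝ ∞ f) (hxs : IsPeriodicOrbit f T xs)
    (hδ0 : 0 < δ) (hδ : δ < T) {p q : ℝ → (Fin n → ℂ) × (Fin n → ℂ)}
    (hp : IsLinearizedSolution f hT xs δ ε K p) (hq : IsLinearizedSolution f hT xs δ ε K q)
    (h : ∀ t ∈ Icc (-T) 0, p t = q t) : ∀ t ∈ Icc 0 T, p t = q t := by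
  have h2 : ∀ t ∈ Icc 0 T, (p t).2 = (q t).2 := fun t ht => by
    rw [hp.recursion t ht, hq.recursion t ht, h (t - T) ⟨by linarith [ht.1], by linarith [ht.2]⟩]
  set g := IccExtend hT.le ((Icc 0 T).domRestrict fun t => (p t).2) with hg
  have hgc : Continuous g :=
    (continuousOn_iff_continuous_domRestrict.1 hp.continuousOn_snd).Icc_extend'
  have hgp : ∀ t ∈ Icc 0 T, g t = (p t).2 := fun t ht => by
    rw [hg, IccExtend_of_mem _ _ ht]; rfl
  obtain ⟨x, -, -, hx⟩ := exists_unique_impulsive hT (continuous_cmat_jacX hf hxs)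
    (continuous_cvec_jacU hf hxs) hgc (cvec K) (-1) hδ0 hδ (p 0).1
  have key : ∀ r : ℝ → (Fin n → ℂ) × (Fin n → ℂ), IsLinearizedSolution f hT xs δ ε K r →
      (r 0).1 = (p 0).1 → (∀ t ∈ Icc 0 T, (p t).2 = (r t).2) →
      ∀ t ∈ Icc 0 T, (r t).1 = x t := fun r hr h0 hr2 => by
    refine hx (fun t => (r t).1) hr.continuousOn_fst fun t ht => ?_
    rw [hr.ode t ht, h0]
    congr 1
    refine intervalIntegral.integral_congr fun s hs => ?_
    rw [uIcc_of_le ht.1] at hs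
    have hs' : s ∈ Icc 0 T := ⟨hs.1, hs.2.trans ht.2⟩
    simp only [linearizedField_eq hf, hgp s hs', hr2 s hs', neg_one_smul, sub_eq_add_neg]
  intro t ht
  refine Prod.ext ?_ (h2 t ht)
  rw [key p hp rfl (fun _ _ => rfl) t ht,
    key q hq (by rw [h 0 ⟨by linarith, le_rfl⟩]) h2 t ht]

/-- A solution whose components are proportional vanishes if it vanishes at time `0`. -/
theorem IsLinearizedSolution.eq_zero_of_proportional (hf : ContDiff ℝ ∞ f)
    (hxs : IsPeriodicOrbit f T xs) (hδ0 : 0 < δ) (hδ : δ < T)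
    {p : ℝ → (Fin n → ℂ) × (Fin n → ℂ)} (hp : IsLinearizedSolution f hT xs δ ε K p)
    (h0 : (p 0).1 = 0) {ρ : ℂ} (hρ : ∀ t ∈ Icc 0 T, (p t).2 = ρ • (p t).1) :
    ∀ t ∈ Icc 0 T, p t = 0 := by
  obtain ⟨x, -, -, hx⟩ := exists_unique_impulsive hT (continuous_cmat_jacX hf hxs)
    (continuous_cvec_jacU hf hxs) (g := fun _ => 0) continuous_const (cvec K) (ρ - 1) hδ0 hδ 0
  have h1 := hx (fun t => (p t).1) hp.continuousOn_fst fun t ht => by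
    rw [hp.ode t ht, h0]
    congr 1
    refine intervalIntegral.integral_congr fun s hs => ?_
    rw [uIcc_of_le ht.1] at hs
    have hs' : s ∈ Icc 0 T := ⟨hs.1, hs.2.trans ht.2⟩
    simp only [linearizedField_eq hf, hρ s hs', sub_smul, one_smul, zero_add]
  have h2 := hx (fun _ => 0) continuousOn_const fun t ht => by simp
  intro t ht
  have h3 : (p t).1 = 0 := (h1 ht).trans (h2 ht).symm
  exact Prod.ext h3 (by rw [hρ t ht, h3, smul_zero]; rfl)

theorem IsLinearizedSolution.intervalIntegrable (hf : ContDiff ℝ ∞ f)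
    (hxs : IsPeriodicOrbit f T xs) (hδ0 : 0 < δ) (hδ : δ < T)
    {p : ℝ → (Fin n → ℂ) × (Fin n → ℂ)} (hp : IsLinearizedSolution f hT xs δ ε K p) {t : ℝ}
    (ht : t ∈ Icc 0 T) :
    IntervalIntegrable (fun s => linearizedField f hT xs δ K s (p s)) volume 0 t := by
  refine IntervalIntegrable.mono_set (b := T) (a := 0) ?_ ?_
  · have h1 : IntervalIntegrable (fun s => cmat (jacX f xs s) *ᵥ (p s).1) volume 0 T := by
      refine ContinuousOn.intervalIntegrable ?_
      rw [uIcc_of_le hT.le]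
      exact continuousOn_mulVec (continuous_cmat_jacX hf hxs).continuousOn hp.continuousOn_fst
    have hKc : ContinuousOn (fun s => cvec K ⬝ᵥ ((p s).2 - (p s).1)) (Icc 0 T) := by
      have hc : Continuous fun v : Fin n → ℂ => cvec K ⬝ᵥ v :=
        continuous_const.dotProduct continuous_id
      exact hc.comp_continuousOn (hp.continuousOn_snd.sub hp.continuousOn_fst)
    have h2 := h1.add (intervalIntegrable_impulse_smul hT hδ0 hδ
      (hKc.smul (continuous_cvec_jacU hf hxs).continuousOn))
    simp only [linearizedField_eq hf]
    simpa only [smul_smul, Pi.smul_apply'] using h2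
  · rw [uIcc_of_le ht.1, uIcc_of_le hT.le]
    exact Icc_subset_Icc_right ht.2

theorem IsLinearizedSolution.add_smul (hf : ContDiff ℝ ∞ f) (hxs : IsPeriodicOrbit f T xs)
    (hδ0 : 0 < δ) (hδ : δ < T) {p q : ℝ → (Fin n → ℂ) × (Fin n → ℂ)}
    (hp : IsLinearizedSolution f hT xs δ ε K p) (hq : IsLinearizedSolution f hT xs δ ε K q)
    (c : ℂ) : IsLinearizedSolution f hT xs δ ε K (fun t => p t + c • q t) where
  continuousOn := hp.continuousOn.add (hq.continuousOn.const_smul c)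
  ode t ht := by
    have h : ∀ s, linearizedField f hT xs δ K s (p s + c • q s) =
        linearizedField f hT xs δ K s (p s) + c • linearizedField f hT xs δ K s (q s) := by
      intro s
      simp only [linearizedField_eq hf, Prod.fst_add, Prod.snd_add, Prod.smul_fst, Prod.smul_snd,
        Matrix.mulVec_add, Matrix.mulVec_smul, dotProduct_sub, dotProduct_add, dotProduct_smul,
        smul_eq_mul]
      module
    simp only [h, Prod.fst_add, Prod.smul_fst]
    have hqi : IntervalIntegrable (fun s => c • linearizedField f hT xs δ K s (q s)) volume 0 t :=
      (hq.intervalIntegrable hf hxs hδ0 hδ ht).smul c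
    rw [intervalIntegral.integral_add (hp.intervalIntegrable hf hxs hδ0 hδ ht) hqi,
      intervalIntegral.integral_smul,
      hp.ode t ht, hq.ode t ht]
    module
  recursion t ht := by
    simp only [Prod.fst_add, Prod.snd_add, Prod.smul_fst, Prod.smul_snd]
    rw [hp.recursion t ht, hq.recursion t ht]
    module

/-- Every history in the phase space has a solution: on `[0, T]` the recursion determines `x̃` from
the history, and `x` then solves a Volterra equation. -/
theorem exists_linearizedSolution (hf : ContDiff ℝ ∞ f) (hxs : IsPeriodicOrbit f T xs)
    (hδ0 : 0 < δ) (hδ : δ < T) (z : phaseSpace n hT ε) :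
    ∃ p, IsLinearizedSolution f hT xs δ ε K p ∧ ∀ t : Icc (-T) (0 : ℝ), p t = z.1 t := by
  have hle : -T ≤ 0 := by linarith
  set y : ℝ → (Fin n → ℂ) × (Fin n → ℂ) := IccExtend hle z.1 with hy
  have hyc : Continuous y := z.1.continuous.Icc_extend'
  have hyz : ∀ t : Icc (-T) (0 : ℝ), y t = z.1 t := fun t => IccExtend_val _ _ _
  set g : ℝ → Fin n → ℂ := fun t =>
    ((1 - ε : ℝ) : ℂ) • (y (t - T)).2 + (ε : ℂ) • (y (t - T)).1 with hg
  have hyT : Continuous fun t => y (t - T) := hyc.comp (continuous_id.sub continuous_const)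
  have hgc : Continuous g := by
    simp only [hg]
    fun_prop
  have hg0 : g 0 = (y 0).2 := by
    have h := z.2
    change (z.1 ⟨0, _⟩).2 = ((1 - ε : ℝ) : ℂ) • (z.1 ⟨-T, _⟩).2 + (ε : ℂ) • (z.1 ⟨-T, _⟩).1 at h
    rw [← hyz ⟨0, _⟩, ← hyz ⟨-T, _⟩] at h
    simp only [hg, zero_sub]
    exact h.symm
  obtain ⟨x, hxc, hx, -⟩ := exists_unique_impulsive hT (continuous_cmat_jacX hf hxs)
    (continuous_cvec_jacU hf hxs) hgc (cvec K) (-1) hδ0 hδ (y 0).1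
  have hx0 : x 0 = (y 0).1 := by simpa using hx 0 ⟨le_rfl, hT.le⟩
  set p : ℝ → (Fin n → ℂ) × (Fin n → ℂ) := fun t => if t ≤ 0 then y t else (x t, g t) with hp
  have hpneg : ∀ t ≤ 0, p t = y t := fun t ht => if_pos ht
  have hppos : ∀ t, 0 ≤ t → p t = (x t, g t) := fun t ht => by
    rcases ht.eq_or_lt with rfl | h
    · rw [hpneg 0 le_rfl, hx0, hg0]
    · exact if_neg (not_le.2 h)
  refine ⟨p, ⟨?_, fun t ht => ?_, fun t ht => ?_⟩, fun t => ?_⟩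
  · refine Continuous.continuousOn (Continuous.if_le hyc (hxc.prodMk hgc) continuous_id
      continuous_const fun t ht => ?_)
    rw [ht, hx0, hg0]
  · rw [hppos t ht.1, hppos 0 le_rfl, hx0]
    simp only
    rw [hx t ht]
    congr 1
    refine intervalIntegral.integral_congr fun s hs => ?_
    rw [uIcc_of_le ht.1] at hs
    simp only [linearizedField_eq hf, hppos s hs.1, neg_one_smul, sub_eq_add_neg]
  · rw [hppos t ht.1, hpneg (t - T) (by linarith [ht.2])]
  · rw [hpneg t t.2.2, hyz]

/-- The time-`T` map is well defined. -/
theorem exists_isTimeTMap (hf : ContDiff ℝ ∞ f) (hxs : IsPeriodicOrbit f T xs)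
    (hδ0 : 0 < δ) (hδ : δ < T) :
    ∃ M : Module.End ℂ (phaseSpace n hT ε), IsTimeTMap f hT xs δ ε K M := by
  let Rel : phaseSpace n hT ε → phaseSpace n hT ε → Prop := fun z w =>
    ∃ p : ℝ → (Fin n → ℂ) × (Fin n → ℂ), IsLinearizedSolution f hT xs δ ε K p ∧
      (∀ t : Icc (-T) (0 : ℝ), p t = z.1 t) ∧ (∀ t : Icc (-T) (0 : ℝ), p (t + T) = w.1 t)
  have hex : ∀ z, ∃ w, Rel z w := by
    intro z
    obtain ⟨p, hp, hpz⟩ := exists_linearizedSolution (K := K) hf hxs hδ0 hδ z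
    refine ⟨⟨⟨fun t => p (t + T), ?_⟩, ?_⟩, p, hp, hpz, fun t => rfl⟩
    · refine hp.continuousOn.comp_continuous (by fun_prop) fun t => ?_
      exact ⟨by linarith [t.2.1], by linarith [t.2.2]⟩
    · change (p (0 + T)).2 = ((1 - ε : ℝ) : ℂ) • (p (-T + T)).2 + (ε : ℂ) • (p (-T + T)).1
      rw [zero_add, hp.recursion T ⟨hT.le, le_rfl⟩, sub_self, neg_add_cancel]
  have huniq : ∀ z w w', Rel z w → Rel z w' → w = w' := by
    rintro z w w' ⟨p, hp, hpz, hpw⟩ ⟨q, hq, hqz, hqw⟩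
    have h := hp.unique hf hxs hδ0 hδ hq fun t ht => by
      rw [hpz ⟨t, ht⟩, hqz ⟨t, ht⟩]
    refine Subtype.ext (ContinuousMap.ext fun t => ?_)
    rw [← hpw, ← hqw]
    exact h _ ⟨by linarith [t.2.1], by linarith [t.2.2]⟩
  have hlin : ∀ z w z' w' (c : ℂ), Rel z w → Rel z' w' → Rel (z + c • z') (w + c • w') := by
    rintro z w z' w' c ⟨p, hp, hpz, hpw⟩ ⟨q, hq, hqz, hqw⟩
    refine ⟨_, hp.add_smul hf hxs hδ0 hδ hq c, fun t => ?_, fun t => ?_⟩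
    · rw [hpz, hqz]; rfl
    · rw [hpw, hqw]; rfl
  choose m hm using hex
  refine ⟨⟨⟨m, fun z z' => ?_⟩, fun c z => ?_⟩, fun z w => ⟨?_, fun h => huniq _ _ _ (hm z) h⟩⟩
  · have := hlin _ _ _ _ 1 (hm z) (hm z')
    rw [one_smul, one_smul] at this
    exact huniq _ _ _ (hm _) this
  · have h0 : m 0 = 0 := by
      have := hlin _ _ _ _ (-1) (hm 0) (hm 0)
      rw [neg_one_smul, neg_one_smul, add_neg_cancel, add_neg_cancel] at this
      exact huniq _ _ _ (hm 0) this
    have := hlin _ _ _ _ c (hm 0) (hm z)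
    rw [h0, zero_add, zero_add] at this
    exact huniq _ _ _ (hm _) this
  · rintro rfl
    exact hm z

end TimeTMap

/-- Criterion for `1` to be a simple eigenvalue: the kernel of `M - 1` is spanned by a vector that
is not in the range of `M - 1`. -/
theorem finrank_maxGenEigenspace_one_eq_one {E : Type*} [AddCommGroup E] [Module ℂ E]
    (M : Module.End ℂ E) {v : E} (hv : v ≠ 0) (hMv : M v = v)
    (hker : ∀ u, M u = u → ∃ c : ℂ, u = c • v) (hrange : ∀ u, M u ≠ u + v) :
    Module.finrank ℂ (M.maxGenEigenspace 1) = 1 := by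
  have hstep : ∀ u, (M - (1 : ℂ) • 1) ((M - (1 : ℂ) • 1) u) = 0 → (M - (1 : ℂ) • 1) u = 0 := by
    intro u hu
    have hN : ∀ u, (M - (1 : ℂ) • 1) u = M u - u := fun u => by simp
    rw [hN, hN] at hu
    obtain ⟨c, hc⟩ := hker _ (sub_eq_zero.1 hu)
    rw [hN, hc]
    by_cases hc0 : c = 0
    · rw [hc0, zero_smul]
    · refine absurd ?_ (hrange (c⁻¹ • u))
      rw [map_smul, ← sub_eq_iff_eq_add', ← smul_sub, hc, smul_smul, inv_mul_cancel₀ hc0, one_smul]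
  have hpow : ∀ (k : ℕ) u, ((M - (1 : ℂ) • 1) ^ k) u = 0 → M u = u := by
    intro k
    induction k with
    | zero =>
      intro u hu
      have : u = 0 := by simpa using hu
      rw [this, map_zero]
    | succ k ih =>
      intro u hu
      rw [pow_succ, Module.End.mul_apply] at hu
      have h1 := ih _ hu
      have h2 : (M - (1 : ℂ) • 1) ((M - (1 : ℂ) • 1) u) = 0 := by
        nth_rewrite 1 [LinearMap.sub_apply]
        rw [h1]
        simp
      have h3 := hstep u h2
      simpa [sub_eq_zero] using h3
  have hspan : M.maxGenEigenspace 1 = Submodule.span ℂ {v} := by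
    ext u
    rw [Module.End.mem_maxGenEigenspace, Submodule.mem_span_singleton]
    constructor
    · rintro ⟨k, hk⟩
      obtain ⟨c, hc⟩ := hker u (hpow k u hk)
      exact ⟨c, hc.symm⟩
    · rintro ⟨c, rfl⟩
      exact ⟨1, by simp [hMv]⟩
  rw [hspan, finrank_span_singleton hv]

/-! ### The Floquet multipliers -/

section Multipliers

variable {n : ℕ} {f : (Fin n → ℝ) × ℝ → (Fin n → ℝ)} {T : ℝ} {xs : ℝ → Fin n → ℝ} {hT : 0 < T}
  {δ ε : ℝ} {K : Fin n → ℝ}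

/-- The velocity of the periodic orbit at time `t`, as a complex vector. -/
noncomputable def velocity (f : (Fin n → ℝ) × ℝ → (Fin n → ℝ)) (xs : ℝ → Fin n → ℝ) (t : ℝ) :
    Fin n → ℂ :=
  cvec (f (xs t, 0))

theorem hasDerivAt_cvec_velocity (hf : ContDiff ℝ ∞ f) (hxs : IsPeriodicOrbit f T xs) (t : ℝ) :
    HasDerivAt (velocity f xs) (cmat (jacX f xs t) *ᵥ velocity f xs t) t := by
  rw [velocity, cmat_mulVec]
  exact hasDerivAt_pi.2 fun i =>
    (hasDerivAt_pi.1 (hasDerivAt_velocity hf hxs t) i).ofReal_comp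

theorem continuous_velocity (hf : ContDiff ℝ ∞ f) (hxs : IsPeriodicOrbit f T xs) :
    Continuous (velocity f xs) :=
  continuous_iff_continuousAt.2 fun t => (hasDerivAt_cvec_velocity hf hxs t).continuousAt

theorem velocity_add_period (hxs : IsPeriodicOrbit f T xs) (t : ℝ) :
    velocity f xs (t + T) = velocity f xs t := by
  rw [velocity, velocity, hxs.periodic t]

/-- The velocity of the periodic orbit solves the linearised system: the control vanishes along
it. -/
theorem isLinearizedSolution_velocity (hf : ContDiff ℝ ∞ f) (hxs : IsPeriodicOrbit f T xs) :
    IsLinearizedSolution f hT xs δ ε K (fun t => (velocity f xs t, velocity f xs t)) where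
  continuousOn :=
    ((continuous_velocity hf hxs).prodMk (continuous_velocity hf hxs)).continuousOn
  ode t ht := by
    simp only [linearizedField_eq hf, sub_self, dotProduct_zero, mul_zero, zero_smul, add_zero]
    exact eq_integral_of_hasDerivWithinAt ((continuous_cmat_jacX hf hxs).matrix_mulVec
      (continuous_velocity hf hxs)).continuousOn
      (fun s _ => (hasDerivAt_cvec_velocity hf hxs s).hasDerivWithinAt) ht
  recursion t _ := by
    have h := velocity_add_period hxs (t - T)
    rw [sub_add_cancel] at h
    simp only [h]
    push_cast
    module

/-- The velocity of the periodic orbit as an element of the phase space. -/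
noncomputable def velocityHistory (hf : ContDiff ℝ ∞ f) (hxs : IsPeriodicOrbit f T xs)
    (hT : 0 < T) (ε : ℝ) : phaseSpace n hT ε :=
  ⟨⟨fun t => (velocity f xs t, velocity f xs t),
    ((continuous_velocity hf hxs).prodMk (continuous_velocity hf hxs)).comp
      continuous_subtype_val⟩, by
    change velocity f xs 0 = ((1 - ε : ℝ) : ℂ) • velocity f xs (-T) + (ε : ℂ) • velocity f xs (-T)
    have h := velocity_add_period hxs (-T)
    rw [neg_add_cancel] at h
    rw [h]
    push_cast
    module⟩

theorem IsTimeTMap.map_velocityHistory (hf : ContDiff ℝ ∞ f) (hxs : IsPeriodicOrbit f T xs)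
    {M : Module.End ℂ (phaseSpace n hT ε)} (hM : IsTimeTMap f hT xs δ ε K M) :
    M (velocityHistory hf hxs hT ε) = velocityHistory hf hxs hT ε := by
  refine (hM _ _).2 ⟨_, isLinearizedSolution_velocity hf hxs, fun t => rfl, fun t => ?_⟩
  simp only [velocity_add_period hxs]
  rfl

/-- The solution witnessing `M z = w`, on `[-T, 0]` and on `[0, T]`. -/
theorem IsTimeTMap.exists_solution {M : Module.End ℂ (phaseSpace n hT ε)}
    (hM : IsTimeTMap f hT xs δ ε K M) (z : phaseSpace n hT ε) :
    ∃ p, IsLinearizedSolution f hT xs δ ε K p ∧ (∀ t : Icc (-T) (0 : ℝ), p t = z.1 t) ∧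
      (∀ t : Icc (-T) (0 : ℝ), p (t + T) = (M z).1 t) :=
  (hM z (M z)).1 rfl

variable {Y Z : ℝ → Matrix (Fin n) (Fin n) ℂ}

/-- In the coordinates `X = Y⁻¹ x` moving with the uncontrolled flow, the first component of a
solution is driven by the control alone, and only during the impulse. -/
theorem IsLinearizedSolution.exists_coordinates (hf : ContDiff ℝ ∞ f)
    (hxs : IsPeriodicOrbit f T xs) (hδ0 : 0 < δ) (hδ : δ < T) (hZ0 : Z 0 = 1)
    (hZY : ∀ t ∈ Icc 0 T, Z t * Y t = 1)
    (hZ : ∀ t ∈ Icc 0 T, ∀ i j, HasDerivWithinAt (fun r => Z r i j)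
      ((-(Z t * cmat (jacX f xs t))) i j) (Icc 0 T) t)
    {p : ℝ → (Fin n → ℂ) × (Fin n → ℂ)} (hp : IsLinearizedSolution f hT xs δ ε K p) :
    ∃ X : ℝ → Fin n → ℂ, X 0 = (p 0).1 ∧ Y T *ᵥ X 1 = (p T).1 ∧
      (∀ θ ∈ Icc (0 : ℝ) 1, Y (δ * θ) *ᵥ X θ = (p (δ * θ)).1) ∧
      ∀ θ ∈ Icc (0 : ℝ) 1, HasDerivWithinAt X
        ((cvec K ⬝ᵥ ((p (δ * θ)).2 - (p (δ * θ)).1)) •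
          (Z (δ * θ) *ᵥ cvec (jacU f xs (δ * θ)))) (Icc 0 1) θ := by
  have hc : Continuous fun v : Fin n → ℂ => cvec K ⬝ᵥ v :=
    continuous_const.dotProduct continuous_id
  exact impulsive_variation_of_constants hT (continuous_cmat_jacX hf hxs)
    (continuous_cvec_jacU hf hxs) hZ0 hZY hZ hδ0 hδ hp.continuousOn_fst
    (hc.comp_continuousOn (hp.continuousOn_snd.sub hp.continuousOn_fst)) fun t ht => by
      rw [hp.ode t ht]
      simp only [linearizedField_eq hf, Function.comp, Pi.sub_apply]

/-- An eigenfunction with multiplier `λ ∉ {1, 1 - ε}` has `x̃ = ε / (λ - 1 + ε) x`, so that the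
control is `-μ K x` with `μ = (λ - 1) / (λ - 1 + ε)`. -/
theorem IsTimeTMap.norm_lt_one_of_hasEigenvalue (hf : ContDiff ℝ ∞ f)
    (hxs : IsPeriodicOrbit f T xs) (hδ0 : 0 < δ) (hδ : δ < T) (hε0 : 0 < ε) (hε1 : ε < 1)
    (hZ0 : Z 0 = 1)
    (hZY : ∀ t ∈ Icc 0 T, Z t * Y t = 1)
    (hZ : ∀ t ∈ Icc 0 T, ∀ i j, HasDerivWithinAt (fun r => Z r i j)
      ((-(Z t * cmat (jacX f xs t))) i j) (Icc 0 T) t)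
    {w : Fin n → ℂ} (hw : w ᵥ* Y T = w)
    (hex : ExcludesUnstable (Y T) w (fun t => Z t *ᵥ cvec (jacU f xs t))
      (fun t => cvec K ᵥ* Y t) ε δ)
    {M : Module.End ℂ (phaseSpace n hT ε)} (hM : IsTimeTMap f hT xs δ ε K M) {l : ℂ}
    (hl : M.HasEigenvalue l) (hl1 : l ≠ 1) : ‖l‖ < 1 := by
  by_contra! hnorm
  obtain ⟨z, hz⟩ := hl.exists_hasEigenvector
  obtain ⟨p, hp, hpz, hpM⟩ := hM.exists_solution z
  rw [hz.apply_eq_smul] at hpM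
  have hshift : ∀ t ∈ Icc (-T) 0, p (t + T) = l • p t := fun t ht => by
    rw [hpM ⟨t, ht⟩, hpz ⟨t, ht⟩]; rfl
  have hl0 : l ≠ 0 := fun h => by
    rw [h, norm_zero] at hnorm
    exact absurd hnorm (by norm_num)
  have hs : l - 1 + ε ≠ 0 := feedback_factor_ne hε0 hε1 hnorm
  set μ : ℂ := (l - 1) / (l - 1 + ε) with hμ
  have hμ0 : μ ≠ 0 := div_ne_zero (sub_ne_zero.2 hl1) hs
  have hρ : 1 - μ = ε / (l - 1 + ε) := by
    rw [hμ]; field_simp; ring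
  have hprop : ∀ t ∈ Icc 0 T, (p t).2 = (1 - μ) • (p t).1 := fun t ht => by
    have ht' : t - T ∈ Icc (-T) 0 := ⟨by linarith [ht.1], by linarith [ht.2]⟩
    have h1 := hp.recursion t ht
    have h2 := hshift (t - T) ht'
    rw [sub_add_cancel] at h2
    rw [h2] at h1 ⊢
    simp only [Prod.smul_fst, Prod.smul_snd] at h1 ⊢
    have h3 : (l - 1 + ε) • (p (t - T)).2 = (ε : ℂ) • (p (t - T)).1 := by
      push_cast at h1
      rw [show l - 1 + (ε : ℂ) = l - (1 - ε) by ring, sub_smul, h1]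
      abel
    have h4 : (p (t - T)).2 = (1 - μ) • (p (t - T)).1 := by
      rw [hρ, div_eq_inv_mul, mul_smul, ← h3, smul_smul, inv_mul_cancel₀ hs, one_smul]
    rw [h4, smul_comm]
  have hp0 : (p 0).1 ≠ 0 := by
    intro h0
    have h1 := hp.eq_zero_of_proportional hf hxs hδ0 hδ h0 hprop
    refine hz.2 (Subtype.ext (ContinuousMap.ext fun t => ?_))
    have h2 := hshift t t.2
    rw [h1 _ ⟨by linarith [t.2.1], by linarith [t.2.2]⟩, hpz] at h2
    exact (smul_eq_zero.1 h2.symm).resolve_left hl0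
  obtain ⟨X, hX0, hX1, hXY, hX⟩ := hp.exists_coordinates hf hxs hδ0 hδ hZ0 hZY hZ
  have hmem : ∀ θ ∈ Icc (0 : ℝ) 1, δ * θ ∈ Icc 0 T := fun θ hθ =>
    ⟨mul_nonneg hδ0.le hθ.1, (mul_le_of_le_one_right hδ0.le hθ.2).trans hδ.le⟩
  have hXR : ∀ θ, (p 0).1 - μ • (μ⁻¹ • ((p 0).1 - X θ)) = X θ := fun θ => by
    rw [smul_smul, mul_inv_cancel₀ hμ0, one_smul, sub_sub_cancel]
  have hend : Y T *ᵥ X 1 = l • (p 0).1 := by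
    have h := hshift 0 ⟨by linarith, le_rfl⟩
    rw [zero_add] at h
    rw [hX1, h]
    rfl
  refine hex l (p 0).1 (fun θ => μ⁻¹ • ((p 0).1 - X θ)) hnorm hp0 (by simp [hX0])
    (fun θ hθ => ?_) (by simp only [← hμ, hXR, hend]) ?_
  · refine (((hX θ hθ).const_sub (p 0).1).const_smul μ⁻¹).congr_deriv ?_
    simp only [← hμ, hXR]
    rw [hprop _ (hmem θ hθ), ← hXY θ hθ, ← Matrix.dotProduct_mulVec,
      show (1 - μ) • (Y (δ * θ) *ᵥ X θ) - Y (δ * θ) *ᵥ X θ = (-μ) • (Y (δ * θ) *ᵥ X θ) by module,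
      dotProduct_smul, smul_eq_mul, ← neg_smul, smul_smul, neg_mul, neg_neg, ← mul_assoc,
      inv_mul_cancel₀ hμ0, one_mul]
  · have h := congrArg (w ⬝ᵥ ·) hend
    simp only [Matrix.dotProduct_mulVec, hw, dotProduct_smul, smul_eq_mul] at h
    simp only [dotProduct_smul, dotProduct_sub, smul_eq_mul, h, hμ]
    have := sub_ne_zero.2 hl1
    field_simp
    ring

/-- Fixed points of the time-`T` map have `x̃ = x`, so they are periodic solutions of the
uncontrolled variational equation. -/
theorem IsTimeTMap.eq_smul_velocityHistory (hf : ContDiff ℝ ∞ f)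
    (hxs : IsPeriodicOrbit f T xs) (hδ0 : 0 < δ) (hδ : δ < T) (hε0 : 0 < ε) (hZ0 : Z 0 = 1)
    (hZY : ∀ t ∈ Icc 0 T, Z t * Y t = 1)
    (hZ : ∀ t ∈ Icc 0 T, ∀ i j, HasDerivWithinAt (fun r => Z r i j)
      ((-(Z t * cmat (jacX f xs t))) i j) (Icc 0 T) t)
    (hker : ∀ y, Y T *ᵥ y = y → ∃ c : ℂ, y = c • velocity f xs 0)
    {M : Module.End ℂ (phaseSpace n hT ε)} (hM : IsTimeTMap f hT xs δ ε K M)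
    {u : phaseSpace n hT ε} (hu : M u = u) : ∃ c : ℂ, u = c • velocityHistory hf hxs hT ε := by
  obtain ⟨p, hp, hpu, hpM⟩ := hM.exists_solution u
  rw [hu] at hpM
  have hshift : ∀ t ∈ Icc (-T) 0, p (t + T) = p t := fun t ht => by
    rw [hpM ⟨t, ht⟩, hpu ⟨t, ht⟩]
  have hεc : (ε : ℂ) ≠ 0 := by exact_mod_cast hε0.ne'
  have hprop : ∀ t ∈ Icc 0 T, (p t).2 = (p t).1 := fun t ht => by
    have ht' : t - T ∈ Icc (-T) 0 := ⟨by linarith [ht.1], by linarith [ht.2]⟩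
    have h1 := hp.recursion t ht
    have h2 := hshift (t - T) ht'
    rw [sub_add_cancel] at h2
    rw [← h2] at h1
    have h3 : (ε : ℂ) • ((p t).2 - (p t).1) = 0 := by
      rw [smul_sub, sub_eq_zero]
      push_cast at h1
      rw [sub_smul, one_smul, sub_add, eq_sub_iff_add_eq, add_eq_left, sub_eq_zero] at h1
      exact h1
    exact sub_eq_zero.1 ((smul_eq_zero.1 h3).resolve_left hεc)
  obtain ⟨X, hX0, hX1, -, hX⟩ := hp.exists_coordinates hf hxs hδ0 hδ hZ0 hZY hZ
  have hXconst : X 1 = X 0 := eq_left_of_hasDerivWithinAt_zero (a := 0) (b := 1) (fun θ hθ => by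
    have h := hX θ hθ
    rw [hprop _ ⟨mul_nonneg hδ0.le hθ.1, (mul_le_of_le_one_right hδ0.le hθ.2).trans hδ.le⟩,
      sub_self, dotProduct_zero, zero_smul] at h
    exact h) (by simp)
  obtain ⟨c, hc⟩ := hker (p 0).1 (by
    have h := hshift 0 ⟨by linarith, le_rfl⟩
    rw [zero_add] at h
    rwa [hXconst, hX0, h] at hX1)
  refine ⟨c, Subtype.ext (ContinuousMap.ext fun t => ?_)⟩
  have hq := (hp.add_smul hf hxs hδ0 hδ (isLinearizedSolution_velocity hf hxs)
    (-c)).eq_zero_of_proportional hf hxs hδ0 hδ (ρ := 1)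
    (by simp [hc]) (fun s hs => by simp [hprop s hs])
  have h1 := hq (t + T) ⟨by linarith [t.2.1], by linarith [t.2.2]⟩
  rw [hpM t, velocity_add_period hxs, neg_smul, ← sub_eq_add_neg, sub_eq_zero] at h1
  exact h1

/-- The velocity is not in the range of `M - 1`: a preimage would have
`x̃ - x = -velocity / ε`. -/
theorem IsTimeTMap.map_ne_add_velocityHistory (hf : ContDiff ℝ ∞ f)
    (hxs : IsPeriodicOrbit f T xs) (hδ0 : 0 < δ) (hδ : δ < T) (hε0 : 0 < ε) (hZ0 : Z 0 = 1)
    (hZY : ∀ t ∈ Icc 0 T, Z t * Y t = 1)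
    (hZ : ∀ t ∈ Icc 0 T, ∀ i j, HasDerivWithinAt (fun r => Z r i j)
      ((-(Z t * cmat (jacX f xs t))) i j) (Icc 0 T) t)
    (hYv : ∀ t ∈ Icc 0 T, Y t *ᵥ velocity f xs 0 = velocity f xs t)
    (hv0 : velocity f xs 0 ≠ 0) {w : Fin n → ℂ} (hw : w ᵥ* Y T = w)
    (hex : ExcludesUnstable (Y T) w (fun t => Z t *ᵥ cvec (jacU f xs t))
      (fun t => cvec K ᵥ* Y t) ε δ)
    {M : Module.End ℂ (phaseSpace n hT ε)} (hM : IsTimeTMap f hT xs δ ε K M)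
    (u : phaseSpace n hT ε) : M u ≠ u + velocityHistory hf hxs hT ε := by
  intro hu
  obtain ⟨p, hp, hpu, hpM⟩ := hM.exists_solution u
  rw [hu] at hpM
  set v := velocity f xs with hv
  have hshift : ∀ t ∈ Icc (-T) 0, p (t + T) = p t + (v t, v t) := fun t ht => by
    rw [hpM ⟨t, ht⟩, hpu ⟨t, ht⟩]; rfl
  have hεc : (ε : ℂ) ≠ 0 := by exact_mod_cast hε0.ne'
  have hprop : ∀ t ∈ Icc 0 T, (p t).2 - (p t).1 = (-(ε : ℂ)⁻¹) • v t := fun t ht => by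
    have ht' : t - T ∈ Icc (-T) 0 := ⟨by linarith [ht.1], by linarith [ht.2]⟩
    have h1 := hp.recursion t ht
    have h2 := hshift (t - T) ht'
    have hvt : v (t - T) = v t := by
      have := velocity_add_period hxs (t - T)
      rw [sub_add_cancel] at this
      exact this.symm
    rw [sub_add_cancel, hvt] at h2
    rw [h2] at h1 ⊢
    simp only [Prod.fst_add, Prod.snd_add] at h1 ⊢
    rw [add_sub_add_right_eq_sub]
    have h3 : (ε : ℂ) • ((p (t - T)).2 - (p (t - T)).1) = -v t := by
      rw [eq_neg_iff_add_eq_zero]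
      push_cast at h1
      rw [sub_smul, one_smul, ← sub_eq_zero] at h1
      rw [← h1]
      module
    rw [neg_smul, ← smul_neg, ← h3, smul_smul, inv_mul_cancel₀ hεc, one_smul]
  obtain ⟨X, hX0, hX1, -, hX⟩ := hp.exists_coordinates hf hxs hδ0 hδ hZ0 hZY hZ
  have hmem : ∀ θ ∈ Icc (0 : ℝ) 1, δ * θ ∈ Icc 0 T := fun θ hθ =>
    ⟨mul_nonneg hδ0.le hθ.1, (mul_le_of_le_one_right hδ0.le hθ.2).trans hδ.le⟩
  refine hex 1 (v 0) (fun θ => (ε : ℂ) • ((p 0).1 - X θ)) (by simp) hv0 (by simp [hX0])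
    (fun θ hθ => ?_) ?_ ?_
  · refine (((hX θ hθ).const_sub (p 0).1).const_smul (ε : ℂ)).congr_deriv ?_
    rw [hprop _ (hmem θ hθ), sub_self, zero_div, zero_smul, sub_zero, ← Matrix.dotProduct_mulVec,
      hYv _ (hmem θ hθ), dotProduct_smul, smul_eq_mul, ← neg_smul, smul_smul, neg_mul, neg_neg,
      ← mul_assoc, mul_inv_cancel₀ hεc, one_mul]
  · have h := velocity_add_period hxs 0
    rw [zero_add] at h
    simp only [sub_self, zero_div, zero_smul, sub_zero, one_smul]
    rw [hYv T ⟨hT.le, le_rfl⟩, hv, h]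
  · have hend : Y T *ᵥ X 1 = (p 0).1 + v 0 := by
      have h := hshift 0 ⟨by linarith, le_rfl⟩
      rw [zero_add] at h
      rw [hX1, h]
      rfl
    have h := congrArg (w ⬝ᵥ ·) hend
    simp only [Matrix.dotProduct_mulVec, hw, dotProduct_add] at h
    simp only [dotProduct_smul, dotProduct_sub, smul_eq_mul, h]
    ring

end Multipliers

/-! ### The uncontrolled orbit -/

section Uncontrolled

variable {n : ℕ} {f : (Fin n → ℝ) × ℝ → (Fin n → ℝ)} {T : ℝ} {xs : ℝ → Fin n → ℝ}

/-- The velocity vanishes nowhere, or the orbit would be an equilibrium. -/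
theorem velocity_zero_ne_zero (hxs : IsPeriodicOrbit f T xs)
    {Y : ℝ → Matrix (Fin n) (Fin n) ℂ}
    (hYv : ∀ t ∈ Icc 0 T, Y t *ᵥ velocity f xs 0 = velocity f xs t) : velocity f xs 0 ≠ 0 := by
  intro h0
  have hT := hxs.period_pos
  have hzero : ∀ t ∈ Icc 0 T, f (xs t, 0) = 0 := fun t ht => by
    have h := hYv t ht
    rw [h0, Matrix.mulVec_zero] at h
    ext i
    have := congrFun h i
    simpa [velocity, cvec] using this.symm
  obtain ⟨t, ht⟩ := hxs.nonconstant
  obtain ⟨s, hs, hst⟩ := hxs.periodic.exists_mem_Ico₀ hT t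
  refine ht ?_
  rw [hst]
  have h := eq_integral_of_hasDerivWithinAt (x := xs) (g := fun _ => 0) (a := 0) (b := T)
    continuousOn_const (fun r hr => by
      have := (hxs.solves r).hasDerivWithinAt (s := Icc 0 T)
      rwa [hzero r hr] at this) (Ico_subset_Icc_self hs)
  simpa using h

/-- Left eigenvectors of a controllable pair do not annihilate the input vector. -/
theorem dotProduct_ne_zero_of_isControllable {P : Matrix (Fin n) (Fin n) ℝ} {b : Fin n → ℝ}
    (hc : IsControllable P b) {w : Fin n → ℂ} (hw0 : w ≠ 0) (hw : w ᵥ* cmat P = w) :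
    w ⬝ᵥ cvec b ≠ 0 := by
  intro hwb
  have hpow : ∀ k : ℕ, w ᵥ* cmat P ^ k = w := by
    intro k
    induction k with
    | zero => simp
    | succ k ih => rw [pow_succ, ← Matrix.vecMul_vecMul, ih, hw]
  have hdet : (cmat (Matrix.of fun i j : Fin n => ((P ^ (j : ℕ)).mulVec b) i)).det = 0 := by
    refine Matrix.exists_vecMul_eq_zero_iff.1 ⟨w, hw0, ?_⟩
    ext j
    change w ⬝ᵥ cvec ((P ^ (j : ℕ)) *ᵥ b) = 0
    rw [← cmat_mulVec, ← cmat_pow, Matrix.dotProduct_mulVec, hpow, hwb]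
  have h : (cmat (Matrix.of fun i j : Fin n => ((P ^ (j : ℕ)).mulVec b) i)).det =
      (algebraMap ℝ ℂ) (Matrix.of fun i j : Fin n => ((P ^ (j : ℕ)).mulVec b) i).det :=
    (RingHom.map_det _ _).symm
  rw [h] at hdet
  exact hc (by simpa using hdet)

end Uncontrolled

end DelayedFeedback

open DelayedFeedback Matrix in
theorem theorem1 (n : ℕ) (f : (Fin n → ℝ) × ℝ → (Fin n → ℝ)) (hf : ContDiff ℝ ∞ f)
    (T : ℝ) (xs : ℝ → Fin n → ℝ) (hxs : DelayedFeedback.IsPeriodicOrbit f T xs)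
    (P₀ : Matrix (Fin n) (Fin n) ℝ) (hP₀ : DelayedFeedback.IsMonodromyMatrix f T xs P₀)
    (hctrl : DelayedFeedback.IsControllable P₀ (DelayedFeedback.jacU f xs 0)) :
    ∃ K₀ : Fin n → ℝ, ∃ ε₀ > 0, ∃ δ₀ > 0,
      ∀ ε : ℝ, 0 < ε → ε < ε₀ → ∀ δ : ℝ, 0 < δ → δ < δ₀ →
        ∃ M : Module.End ℂ (DelayedFeedback.phaseSpace n hxs.period_pos ε),
          DelayedFeedback.IsTimeTMap f hxs.period_pos xs δ ε K₀ M ∧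
          Module.finrank ℂ (M.maxGenEigenspace 1) = 1 ∧
          ∀ l : ℂ, M.HasEigenvalue l → l ≠ 1 → ‖l‖ < 1 := by
  have hT := hxs.period_pos
  have hTT : T ∈ Icc (0 : ℝ) T := ⟨hT.le, le_rfl⟩
  obtain ⟨Yr, hYr0, hYr, hYrT⟩ := hP₀
  -- The complexified fundamental matrix and its inverse.
  set Y : ℝ → Matrix (Fin n) (Fin n) ℂ := fun t => cmat (Yr t) with hYdef
  have hA := continuous_cmat_jacX hf hxs
  have hY0 : Y 0 = 1 := by
    simp [hYdef, hYr0]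
  have hYT : Y T = cmat P₀ := by rw [hYdef]; simp only [hYrT]
  have hY : ∀ t ∈ Icc 0 T, ∀ i j, HasDerivWithinAt (fun r => Y r i j)
      ((cmat (jacX f xs t) * Y t) i j) (Icc 0 T) t := fun t ht i j => by
    refine (hYr t ht i j).ofReal_comp.congr_deriv ?_
    simp [hYdef, Matrix.mul_apply]
  obtain ⟨Z, hZ0, hZY, hZ⟩ := exists_inverse_fundamental hA hT.le hY0 hY
  have hYZ : ∀ t ∈ Icc 0 T, Y t * Z t = 1 := fun t ht =>
    mul_eq_one_comm.1 (hZY t ht)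
  have hdetP : P₀.det ≠ 0 := by
    intro h
    have h1 := congrArg Matrix.det (hZY T hTT)
    have h2 : (cmat P₀).det = (algebraMap ℝ ℂ) P₀.det := (RingHom.map_det _ _).symm
    rw [Matrix.det_mul, hYT, h2, h, map_zero, mul_zero, Matrix.det_one] at h1
    exact zero_ne_one h1
  -- The velocity is transported by the variational equation, hence fixed by the monodromy matrix.
  have hYv : ∀ t ∈ Icc 0 T, Y t *ᵥ velocity f xs 0 = velocity f xs t := fun t ht => by
    have hder : ∀ s ∈ Icc 0 T,
        HasDerivWithinAt (fun r => Z r *ᵥ velocity f xs r) 0 (Icc 0 T) s := fun s hs => by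
      refine (hasDerivWithinAt_mulVec (hZ s hs)
        (hasDerivAt_cvec_velocity hf hxs s).hasDerivWithinAt).congr_deriv ?_
      rw [Matrix.neg_mulVec, Matrix.mulVec_mulVec, neg_add_cancel]
    have h := eq_left_of_hasDerivWithinAt_zero hder ht
    rw [hZ0, Matrix.one_mulVec] at h
    rw [← h, Matrix.mulVec_mulVec, hYZ t ht, Matrix.one_mulVec]
  have hv0 := velocity_zero_ne_zero hxs hYv
  have hPv : cmat P₀ *ᵥ velocity f xs 0 = velocity f xs 0 := by
    have h := velocity_add_period hxs 0
    rw [zero_add] at h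
    rw [← hYT, hYv T hTT, h]
  have hn : n ≠ 0 := by
    rintro rfl
    exact hv0 (Subsingleton.elim _ _)
  obtain ⟨w, hw0, hw⟩ : ∃ w : Fin n → ℂ, w ≠ 0 ∧ w ᵥ* cmat P₀ = w := by
    have hdet : (cmat P₀ - 1).det = 0 := Matrix.exists_mulVec_eq_zero_iff.1
      ⟨_, hv0, by rw [Matrix.sub_mulVec, hPv, Matrix.one_mulVec, sub_self]⟩
    obtain ⟨w, hw0, hw⟩ := Matrix.exists_vecMul_eq_zero_iff.2 hdet
    rw [Matrix.vecMul_sub, Matrix.vecMul_one, sub_eq_zero] at hw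
    exact ⟨w, hw0, hw⟩
  obtain ⟨K, hκ, hstab⟩ := exists_stabilizing_gain hn P₀ (jacU f xs 0) hdetP hctrl
  -- Without control, `1` has a one-dimensional eigenspace, on which `K` is injective.
  have hinj : ∀ y, cmat P₀ *ᵥ y = y → cvec K ⬝ᵥ y = 0 → y = 0 := fun y hy hK => by
    by_contra hy0
    have := hstab 1 y hy0 (by rw [hK, mul_zero, zero_smul, sub_zero, hy, one_smul])
    simp at this
  have hKv : cvec K ⬝ᵥ velocity f xs 0 ≠ 0 := fun h => hv0 (hinj _ hPv h)
  have hker : ∀ y, Y T *ᵥ y = y → ∃ c : ℂ, y = c • velocity f xs 0 := fun y hy => by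
    rw [hYT] at hy
    refine ⟨(cvec K ⬝ᵥ y) / (cvec K ⬝ᵥ velocity f xs 0), sub_eq_zero.1 (hinj _ ?_ ?_)⟩
    · rw [Matrix.mulVec_sub, Matrix.mulVec_smul, hy, hPv]
    · rw [dotProduct_sub, dotProduct_smul, smul_eq_mul, div_mul_cancel₀ _ hKv, sub_self]
  set β : ℝ → Fin n → ℂ := fun t => Z t *ᵥ cvec (jacU f xs t) with hβ
  have hβ0 : β 0 = cvec (jacU f xs 0) := by rw [hβ]; simp only [hZ0, Matrix.one_mulVec]
  have hβc : ContinuousOn β (Icc 0 T) := continuousOn_mulVec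
    (continuousOn_matrix_of_hasDerivWithinAt (Z' := fun t => -(Z t * cmat (jacX f xs t))) hZ)
    (continuous_cvec_jacU hf hxs).continuousOn
  have hkc : ContinuousOn (fun t => cvec K ᵥ* Y t) (Icc 0 T) := by
    have hYc : ContinuousOn Y (Icc 0 T) := continuousOn_matrix_of_hasDerivWithinAt
      (Z' := fun t => cmat (jacX f xs t) * Y t) hY
    have hc : Continuous fun B : Matrix (Fin n) (Fin n) ℂ => cvec K ᵥ* B :=
      continuous_const.matrix_vecMul continuous_id
    exact hc.comp_continuousOn hYc
  obtain ⟨r, hr0, hr1, hrT, hr⟩ := exists_excludesUnstable hT (Y T) (K := cvec K) (w := w)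
    (β := β) (k := fun t => cvec K ᵥ* Y t) hκ hβc hkc (by simp only [hY0, Matrix.vecMul_one])
    (by rw [hβ0, cvec_dotProduct])
    (by rw [hβ0]; exact dotProduct_ne_zero_of_isControllable hctrl hw0 hw)
    (by rw [hβ0, hYT]; exact hstab)
  refine ⟨K, r, hr0, r, hr0, fun ε hε0 hεr δ hδ0 hδr => ?_⟩
  have hδT : δ < T := hδr.trans hrT
  have hex := hr ε δ hε0 hεr hδ0 hδr
  have hwT : w ᵥ* Y T = w := by rw [hYT, hw]
  obtain ⟨M, hM⟩ := exists_isTimeTMap (hT := hxs.period_pos) (ε := ε) (K := K) hf hxs hδ0 hδT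
  refine ⟨M, hM, ?_, fun l hl hl1 => hM.norm_lt_one_of_hasEigenvalue hf hxs hδ0 hδT hε0
    (hεr.trans hr1) hZ0 hZY hZ hwT hex hl hl1⟩
  refine finrank_maxGenEigenspace_one_eq_one M (v := velocityHistory hf hxs hT ε) ?_
    (hM.map_velocityHistory hf hxs)
    (fun u hu => hM.eq_smul_velocityHistory hf hxs hδ0 hδT hε0 hZ0 hZY hZ hker hu)
    (fun u => hM.map_ne_add_velocityHistory hf hxs hδ0 hδT hε0 hZ0 hZY hZ hYv hv0 hwT hex u)
  intro h
  have h1 : (velocityHistory hf hxs hT ε).1 ⟨0, by simp [hT.le]⟩ = 0 := by rw [h]; rfl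
  exact hv0 (congrArg Prod.fst h1)
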